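/- Let $(E,h)$ be a Hermitian holomorphic vector bundle of rank $r$ over a complex manifold $X$ of dimension $n$. With respect to a local holomorphic frame $\{e_i\}$ and local holomorphic coordinates $\{z^\alpha\}$, let $R=(R^j_i)$, $R^j_i=R^j_{i\alpha\bar\beta}\,dz^\alpha\wedge d\bar z^\beta$ ($j$ row, $i$ column), be the Chern curvature matrix, i.e. $R=\bar\partial\theta$ with $\theta^\top=\partial h\cdot h^{-1}$, $h=(h_{i\bar k})$, $h_{i\bar k}=h(e_i,e_k)$, and put $R_{i\bar j\alpha\bar\beta}=R^k_{i\alpha\bar\beta}h_{k\bar j}$ (summation convention). $(E,h)$ is called *strongly decomposably non-negative* (resp. *positive*) *of type I* if for every $x\in X$ there is a decomposition $T^{1,0}_xX=U_x\oplus V_x$ into complex subspaces such that, at $x$, $$R_{i\bar j\alpha\bar\beta}u^{i\alpha}\overline{u^{j\beta}}\ge 0\ (\text{resp. }>0),\qquad R_{i\bar j\alpha\bar\beta}u^{i\alpha}\overline{v'^{j\beta}}=0,\qquad R_{i\bar j\alpha\bar\beta}v^{\bar j\alpha}\overline{v^{\bar i\beta}}\ge 0\ (\text{resp. }>0)$$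 for all non-zero $u=u^{i\alpha}e_i\otimes\partial_\alpha\in E_x\otimes U_x$, $v'=v'^{j\beta}e_j\otimes\partial_\beta\in E_x\otimes V_x$ and $v=v^{\bar j\alpha}\bar e_j\otimes\partial_\alpha\in\overline{E}_x\otimes V_x$. For a point $x$ and a unitary frame of $E_x$ consider, for some $N_1,N_2\in\mathbb N$, an $r\times N_2$ matrix $B=(B_{ip})$ of $(0,1)$-forms at $x$ and an $r\times N_1$ matrix $A=(A_{ip})$ of $(1,0)$-forms at $x$ such that the Chern curvature matrix at $x$ with respect to this frame satisfies $$R=-B\wedge\overline B^{\top}+A\wedge\overline A^{\top}\quad(1),\qquad \mathrm{span}_{\mathbb C}\{\overline{B_{ip}}\}\cap\mathrm{span}_{\mathbb C}\{A_{ip}\}=\{0\}\quad(2).$$ Writing $B_{ip}=B_{ip\bar\alpha}d\bar z^\alpha$ and $A_{jp}=A_{jp\alpha}dz^\alpha$, let $\mathbf B=(B_{ip\bar\alpha})_{p,\,i\alpha}$ and $\mathbf A=(A_{jp\alpha})_{p,\,j\alpha}$, matrices with rows indexed by $p$ and columns indexed by $(i,\alpha)$, resp. $(j,\alpha)$, $1\le\alpha\le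 n$. **Theorem.** 1. $(E,h)$ is strongly decomposably non-negative of type I if and only if at each $x\in X$, with respect to some unitary frame of $E_x$, there are $A$, $B$ satisfying (1) and (2); equivalently, if and only if this holds at each $x\in X$ with respect to every unitary frame of $E_x$. 2. $(E,h)$ is strongly decomposably positive of type I if and only if at each $x\in X$, with respect to some unitary frame of $E_x$, there are $A$, $B$ satisfying (1) and (2) and a decomposition $T^{1,0}_xX=U_x\oplus V_x$ with $$\mathrm{rank}(\mathbf A)=r\dim V_x,\qquad \mathrm{rank}(\mathbf B)=r\dim U_x;$$ equivalently, if and only if this holds at each $x\in X$ with respect to every unitary frame of $E_x$, where in addition the decomposition can be chosen so that the $\overline{B_{ip}}$ lie in $U_x^*$ (they vanish on $V_x$) and the $A_{ip}$ lie in $V_x^*$ (they vanish on $U_x$). -/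

import Mathlib

open scoped Manifold Bundle ContDiff ComplexOrder
open Bundle

noncomputable section

namespace ChernCriterion

/-- The model space `ℂⁿ` with its coordinates `z¹, …, zⁿ`. -/
abbrev Cn (n : ℕ) : Type := EuclideanSpace ℂ (Fin n)

/-- The holomorphic tangent space `T^{1,0}_x X` of a complex manifold modelled on `ℂⁿ`. As a real
vector space it is also the real tangent space. Mathlib identifies it with `ℂⁿ` through the
preferred holomorphic chart at `x`. -/
abbrev HolTangent (n : ℕ) {X : Type*} [TopologicalSpace X] [ChartedSpace (Cn n) X] (x : X) :
    Type :=
  TangentSpace 𝓘(ℂ, Cn n) x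

section Wirtinger

variable {n : ℕ}

/-- The coordinate vector `∂/∂z^α` of `ℂⁿ`. -/
def stdVec (α : Fin n) : Cn n := EuclideanSpace.single α 1

/-- The Wirtinger derivative `∂f/∂z^α = (∂f/∂x^α - i ∂f/∂y^α) / 2`. -/
def wirt (α : Fin n) (f : Cn n → ℂ) (z : Cn n) : ℂ :=
  (fderiv ℝ f z (stdVec α) - Complex.I * fderiv ℝ f z (Complex.I • stdVec α)) / 2

/-- The conjugate Wirtinger derivative `∂f/∂z̄^β = (∂f/∂x^β + i ∂f/∂y^β) / 2`. -/
def wirtBar (β : Fin n) (f : Cn n → ℂ) (z : Cn n) : ℂ :=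
  (fderiv ℝ f z (stdVec β) + Complex.I * fderiv ℝ f z (Complex.I • stdVec β)) / 2

/-- The matrix `θ_α` in `θ = θ_α dz^α`, for `θᵀ = ∂h · h⁻¹`: the Chern connection form of the
metric matrix `H = (h_{i k̄})`, as a function of the coordinates. The entry `(j, i)` is `θ^j_{i α}`
(`j` row, `i` column). -/
def connectionForm {r : ℕ} (H : Cn n → Matrix (Fin r) (Fin r) ℂ) (α : Fin n) (z : Cn n) :
    Matrix (Fin r) (Fin r) ℂ :=
  (Matrix.of (fun i k => wirt α (fun w => H w i k) z) * (H z)⁻¹).transpose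

/-- The coefficients `R^j_{i α β̄}` (`j` row, `i` column) of the Chern curvature matrix
`R = ∂̄θ = R_{α β̄} dz^α ∧ dz̄^β`, that is `R_{α β̄} = - ∂θ_α/∂z̄^β`. -/
def curvatureMatrix {r : ℕ} (H : Cn n → Matrix (Fin r) (Fin r) ℂ) (α β : Fin n) (z : Cn n) :
    Matrix (Fin r) (Fin r) ℂ :=
  Matrix.of fun j i => - wirtBar β (fun w => connectionForm H α w j i) z

end Wirtinger

section Bundle

/-- A smooth Hermitian metric on a holomorphic vector bundle `E` of rank `r`: a positive definite
Hermitian form on every fibre, linear in the first variable and conjugate linear in the second,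
whose coefficients in every holomorphic trivialization are smooth functions in the real sense. -/
structure HermitianMetric (n r : ℕ) {X : Type*} [TopologicalSpace X] [ChartedSpace (Cn n) X]
    (E : X → Type*) [TopologicalSpace (TotalSpace (Cn r) E)]
    [∀ x, AddCommGroup (E x)] [∀ x, Module ℂ (E x)] [∀ x, TopologicalSpace (E x)]
    [FiberBundle (Cn r) E] [VectorBundle ℂ (Cn r) E] where
  /-- the Hermitian form on the fibre at `x` -/
  form (x : X) : E x →ₗ[ℂ] E x →ₗ⋆[ℂ] ℂ
  conj_symm (x : X) (v w : E x) : starRingEnd ℂ (form x v w) = form x w v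
  pos (x : X) (v : E x) : v ≠ 0 → 0 < form x v v
  smooth (e : Trivialization (Cn r) (Bundle.TotalSpace.proj : TotalSpace (Cn r) E → X))
    [MemTrivializationAtlas e] (v w : Cn r) :
    ContMDiffOn 𝓘(ℝ, Cn n) 𝓘(ℝ, ℂ) ∞ (fun y => form y (e.symm y v) (e.symm y w)) e.baseSet

variable {n r : ℕ} {X : Type*} [TopologicalSpace X] [ChartedSpace (Cn n) X]
  {E : X → Type*} [TopologicalSpace (TotalSpace (Cn r) E)]
  [∀ x, AddCommGroup (E x)] [∀ x, Module ℂ (E x)] [∀ x, TopologicalSpace (E x)]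
  [FiberBundle (Cn r) E] [VectorBundle ℂ (Cn r) E]

/-- The local holomorphic frame `e_1, …, e_r` of `E` around `x` that is given by the preferred
holomorphic trivialization at `x`. -/
def localFrame (E : X → Type*) [TopologicalSpace (TotalSpace (Cn r) E)]
    [∀ x, AddCommGroup (E x)] [∀ x, Module ℂ (E x)] [∀ x, TopologicalSpace (E x)]
    [FiberBundle (Cn r) E] [VectorBundle ℂ (Cn r) E] (x : X) (i : Fin r) (y : X) : E y :=
  (trivializationAt (Cn r) E x).symm y (stdVec i)

/-- The values at `x` of the local holomorphic frame around `x`, as a basis of `E x`. -/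
def frameBasis (E : X → Type*) [TopologicalSpace (TotalSpace (Cn r) E)]
    [∀ x, AddCommGroup (E x)] [∀ x, Module ℂ (E x)] [∀ x, TopologicalSpace (E x)]
    [FiberBundle (Cn r) E] [VectorBundle ℂ (Cn r) E] (x : X) : Module.Basis (Fin r) ℂ (E x) :=
  (trivializationAt (Cn r) E x).basisAt (EuclideanSpace.basisFun (Fin r) ℂ).toBasis
    (FiberBundle.mem_baseSet_trivializationAt (Cn r) E x)

theorem frameBasis_apply (x : X) (i : Fin r) : frameBasis E x i = localFrame E x i x := by
  simp [frameBasis, localFrame, Trivialization.basisAt, stdVec]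

/-- The metric matrix `h_{i k̄} = h(e_i, e_k)` of the local holomorphic frame around `x`, as a
function of the preferred holomorphic coordinates around `x`. -/
def metricMatrix (h : HermitianMetric n r E) (x : X) (z : Cn n) : Matrix (Fin r) (Fin r) ℂ :=
  Matrix.of fun i k =>
    h.form ((chartAt (Cn n) x).symm z) (localFrame E x i _) (localFrame E x k _)

/-- The endomorphism `R_{α β̄}` of `E x` in the Chern curvature
`R^E_x = R_{α β̄} dz^α ∧ dz̄^β`, for the preferred holomorphic coordinates around `x`. -/
def curvatureEnd (h : HermitianMetric n r E) (x : X) (α β : Fin n) : E x →ₗ[ℂ] E x :=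
  Matrix.toLin (frameBasis E x) (frameBasis E x)
    (curvatureMatrix (metricMatrix h x) α β (chartAt (Cn n) x x))

/-- The covariant coefficients `R_{i j̄ α β̄} = R^k_{i α β̄} h_{k j̄} = h(R_{α β̄} e_i, e_j)` at `x`. -/
def curvatureCoeff (h : HermitianMetric n r E) (x : X) (i j : Fin r) (α β : Fin n) : ℂ :=
  h.form x (curvatureEnd h x α β (frameBasis E x i)) (frameBasis E x j)

/-- The tangent vector `∂_α` at `x`. -/
def tangentVec (x : X) (α : Fin n) : HolTangent n x := stdVec α

/-- The coordinate form `dz^α` at `x`. -/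
def dz (x : X) (α : Fin n) : HolTangent n x →ₗ[ℂ] ℂ :=
  (EuclideanSpace.proj α : Cn n →L[ℂ] ℂ).toLinearMap

/-- The conjugate of a `(1,0)`-form: a `(0,1)`-form. -/
def conj10 {x : X} (η : HolTangent n x →ₗ[ℂ] ℂ) : HolTangent n x →ₗ⋆[ℂ] ℂ where
  toFun v := starRingEnd ℂ (η v)
  map_add' v w := by simp
  map_smul' c v := by simp

/-- The conjugate of a `(0,1)`-form: a `(1,0)`-form. -/
def conj01 {x : X} (η : HolTangent n x →ₗ⋆[ℂ] ℂ) : HolTangent n x →ₗ[ℂ] ℂ where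
  toFun v := starRingEnd ℂ (η v)
  map_add' v w := by simp
  map_smul' c v := by simp

/-- The wedge product of two complex-valued 1-forms on the real tangent space at `x`, evaluated on
two tangent vectors. -/
def wedge {x : X} (η ζ : HolTangent n x → ℂ) (v w : HolTangent n x) : ℂ :=
  η v * ζ w - η w * ζ v

/-- The Chern curvature `R^E_x = R_{α β̄} dz^α ∧ dz̄^β`, a 2-form on the tangent space at `x` with
values in `End (E x)`. -/
def chernCurvature (h : HermitianMetric n r E) (x : X) (v w : HolTangent n x) :
    E x →ₗ[ℂ] E x :=
  ∑ α, ∑ β, wedge (dz x α) (conj10 (dz x β)) v w • curvatureEnd h x α β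

/-- The array `u = (u^{i α})` is the array of coefficients of an element `u^{i α} e_i ⊗ ∂_α` of
`E_x ⊗ U` (or of an element `u^{ī α} ē_i ⊗ ∂_α` of `Ē_x ⊗ U`): every `u^{i α} ∂_α` lies in `U`. -/
def IsTensorIn {x : X} (U : Submodule ℂ (HolTangent n x)) (u : Fin r → Fin n → ℂ) : Prop :=
  ∀ i, ∑ α, u i α • tangentVec x α ∈ U

/-- The Nakano form `R_{i j̄ α β̄} u^{i α} conj(v^{j β})`. -/
def nakanoForm (h : HermitianMetric n r E) (x : X) (u v : Fin r → Fin n → ℂ) : ℂ :=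
  ∑ i, ∑ j, ∑ α, ∑ β, curvatureCoeff h x i j α β * u i α * starRingEnd ℂ (v j β)

/-- The dual Nakano form `R_{i j̄ α β̄} v^{j̄ α} conj(v^{ī β})`. -/
def dualNakanoForm (h : HermitianMetric n r E) (x : X) (v : Fin r → Fin n → ℂ) : ℂ :=
  ∑ i, ∑ j, ∑ α, ∑ β, curvatureCoeff h x i j α β * v j α * starRingEnd ℂ (v i β)

/-- Strongly decomposably non-negative of type I. (The order of `ℂ` is used: `0 ≤ z` says that `z`
is real and non-negative.) -/
def IsStronglyDecomposablyNonnegI (h : HermitianMetric n r E) : Prop :=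
  ∀ x : X, ∃ U V : Submodule ℂ (HolTangent n x), IsCompl U V ∧
    (∀ u, IsTensorIn (r := r) U u → u ≠ 0 → 0 ≤ nakanoForm h x u u) ∧
    (∀ u v, IsTensorIn (r := r) U u → IsTensorIn (r := r) V v → nakanoForm h x u v = 0) ∧
    (∀ v, IsTensorIn (r := r) V v → v ≠ 0 → 0 ≤ dualNakanoForm h x v)

/-- Strongly decomposably positive of type I. -/
def IsStronglyDecomposablyPosI (h : HermitianMetric n r E) : Prop :=
  ∀ x : X, ∃ U V : Submodule ℂ (HolTangent n x), IsCompl U V ∧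
    (∀ u, IsTensorIn (r := r) U u → u ≠ 0 → 0 < nakanoForm h x u u) ∧
    (∀ u v, IsTensorIn (r := r) U u → IsTensorIn (r := r) V v → nakanoForm h x u v = 0) ∧
    (∀ v, IsTensorIn (r := r) V v → v ≠ 0 → 0 < dualNakanoForm h x v)

/-- A basis `e` of the fibre `E x` is a unitary frame at `x`: `h(e_i, e_j) = δ_{ij}`. -/
def IsUnitaryFrame (h : HermitianMetric n r E) {x : X} (e : Module.Basis (Fin r) ℂ (E x)) :
    Prop :=
  ∀ i j, h.form x (e i) (e j) = if i = j then 1 else 0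

/-- With respect to the frame `e` of `E x`, the Chern curvature matrix at `x` is
`R = - B ∧ B̄ᵀ + A ∧ Āᵀ`, with `B` an `r × N₂` matrix of `(0,1)`-forms and `A` an `r × N₁` matrix
of `(1,0)`-forms. -/
def CurvatureFactors (h : HermitianMetric n r E) {x : X} (e : Module.Basis (Fin r) ℂ (E x))
    {N₁ N₂ : ℕ} (B : Matrix (Fin r) (Fin N₂) (HolTangent n x →ₗ⋆[ℂ] ℂ))
    (A : Matrix (Fin r) (Fin N₁) (HolTangent n x →ₗ[ℂ] ℂ)) : Prop :=
  ∀ (v w : HolTangent n x) (j i : Fin r),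
    LinearMap.toMatrix e e (chernCurvature h x v w) j i =
      -(∑ p, wedge (B j p) (conj01 (B i p)) v w) + ∑ p, wedge (A j p) (conj10 (A i p)) v w

/-- `span_ℂ {B̄}`: the span of the conjugates of the entries of `B`. -/
def spanBBar {x : X} {N : ℕ} (B : Matrix (Fin r) (Fin N) (HolTangent n x →ₗ⋆[ℂ] ℂ)) :
    Submodule ℂ (HolTangent n x →ₗ[ℂ] ℂ) :=
  Submodule.span ℂ (Set.range fun q : Fin r × Fin N => conj01 (B q.1 q.2))

/-- `span_ℂ {A}`: the span of the entries of `A`. -/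
def spanA {x : X} {N : ℕ} (A : Matrix (Fin r) (Fin N) (HolTangent n x →ₗ[ℂ] ℂ)) :
    Submodule ℂ (HolTangent n x →ₗ[ℂ] ℂ) :=
  Submodule.span ℂ (Set.range fun q : Fin r × Fin N => A q.1 q.2)

/-- The matrix `𝐁 = (B_{i p ᾱ})_{p, i α}` with rows `p` and columns `(i, α)`, where
`B_{i p} = B_{i p ᾱ} dz̄^α`. All `α = 1, …, n` are kept: the rank does not depend on the
coordinates, and in coordinates adapted to a decomposition `T = U ⊕ V` such that the entries of `B`
vanish on `V` the columns that belong to `V` are zero. -/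
def boldB {x : X} {N : ℕ} (B : Matrix (Fin r) (Fin N) (HolTangent n x →ₗ⋆[ℂ] ℂ)) :
    Matrix (Fin N) (Fin r × Fin n) ℂ :=
  Matrix.of fun p q => B q.1 p (tangentVec x q.2)

/-- The matrix `𝐀 = (A_{j p α})_{p, j α}` with rows `p` and columns `(j, α)`, where
`A_{j p} = A_{j p α} dz^α`. -/
def boldA {x : X} {N : ℕ} (A : Matrix (Fin r) (Fin N) (HolTangent n x →ₗ[ℂ] ℂ)) :
    Matrix (Fin N) (Fin r × Fin n) ℂ :=
  Matrix.of fun p q => A q.1 p (tangentVec x q.2)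

end Bundle

end ChernCriterion

end

noncomputable section

namespace ChernCriterion

/-! ### Linear algebra of arrays of sesquilinear forms -/

section LinearAlgebra

open scoped ComplexConjugate MatrixOrder Matrix.Norms.L2Operator

/-! At a point, in a unitary frame, the curvature is an array of sesquilinear forms `K i j v w` =
h(R(v, w̄) e_i, e_j) with conj (K i j v w) = K j i w v. The curvature 2-form antisymmetrizes `K` in
(v, w), and a sesquilinear form is determined by its antisymmetrization. Hence (1) says exactly that
`K` is a Nakano square built from φ = B̄ plus a dual Nakano square built from ψ = A
(`curvatureFactors_iff`).

From U ⊕ V to the factorization: the Nakano form restricted to U^r has a square root whose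
functionals vanish on V, the dual form restricted to V^r has one whose functionals vanish on U, and
the mixed blocks are zero (`IsNonnegDecomposition.exists_isSumOfSquares`). Condition (2) holds
because the annihilators of U and V meet trivially. Conversely, (2) says dually that the common
kernels of A and of B̄ span the tangent space. Shrinking the first to a complement of the second
gives U and V, and the three conditions can be read off.

For positivity, the Nakano form on U^r is the squared norm of `arrayMap φ`, so it is definite iff
that map is injective on U^r. As the map kills V^r, this means that its rank, which is the rank of
𝐁, equals r dim U. The same holds for A and V. If the ranks are given for an unrelated
decomposition, a dimension count makes the common kernels themselves complementary
(`IsSumOfSquares.exists_isPosDecomposition`).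

A change of frame acts on arrays by an invertible matrix that preserves U^r and V^r, so all frames
are equivalent. The Hermitian symmetry of `K` comes from R h = -∂∂̄h + ∂h h⁻¹ ∂̄h. -/

/-- A positive semidefinite Hermitian form is a sum of squares of linear functionals. -/
theorem exists_sum_mul_conj_of_nonneg {W : Type*} [AddCommGroup W] [Module ℂ W]
    [FiniteDimensional ℂ W] (Q : W →ₗ[ℂ] W →ₗ⋆[ℂ] ℂ) (hsymm : ∀ u v, conj (Q u v) = Q v u)
    (hQ : ∀ w, 0 ≤ Q w w) :
    ∃ (N : ℕ) (φ : Fin N → W →ₗ[ℂ] ℂ), ∀ u v, Q u v = ∑ p, φ p u * conj (φ p v) := by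
  classical
  let b := Module.finBasis ℂ W
  -- The indices are transposed so that x* M x, conjugate linear in the left factor, is `Q` at Σ x_i
  -- b_i.
  let M : Matrix (Fin (Module.finrank ℂ W)) (Fin (Module.finrank ℂ W)) ℂ :=
    Matrix.of fun i j => Q (b j) (b i)
  have expand : ∀ u v, Q u v = ∑ i, ∑ j, b.repr u i * (conj (b.repr v j) * Q (b i) (b j)) := by
    intro u v
    conv_lhs => rw [← b.sum_repr u, ← b.sum_repr v]
    simp only [map_sum, map_smul, LinearMap.sum_apply, LinearMap.smul_apply,
      LinearMap.map_smulₛₗ, smul_eq_mul, Finset.mul_sum]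
    rw [Finset.sum_comm]
    exact Finset.sum_congr rfl fun i _ => Finset.sum_congr rfl fun j _ => by ring
  have hM : M.PosSemidef := by
    refine Matrix.PosSemidef.of_dotProduct_mulVec_nonneg ?_ ?_
    · ext i j
      simp [M, Matrix.conjTranspose_apply, hsymm]
    · intro x
      have := hQ (∑ i, x i • b i)
      rw [expand] at this
      convert this using 1
      simp only [dotProduct, Matrix.mulVec, M, Matrix.of_apply, Finset.mul_sum,
        b.repr_sum_self]
      rw [Finset.sum_comm]
      refine Finset.sum_congr rfl fun i _ => Finset.sum_congr rfl fun j _ => ?_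
      simp only [Pi.star_apply, RCLike.star_def]
      ring
  -- The rows of a square root `C`, with M = C* C, are the required functionals.
  obtain ⟨C, hC⟩ := CStarAlgebra.nonneg_iff_eq_star_mul_self.mp hM.nonneg
  rw [Matrix.star_eq_conjTranspose] at hC
  refine ⟨_, fun p => b.constr ℂ (C p), fun u v => ?_⟩
  have key : ∀ i j, Q (b i) (b j) = ∑ p, C p i * conj (C p j) := by
    intro i j
    have := congrFun (congrFun hC j) i
    simp only [M, Matrix.of_apply, Matrix.mul_apply, Matrix.conjTranspose_apply] at this
    rw [this]
    exact Finset.sum_congr rfl fun p _ => by rw [mul_comm]; rfl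
  rw [expand]
  have hterm : ∀ p, b.constr ℂ (C p) u * conj (b.constr ℂ (C p) v) =
      ∑ i, ∑ j, b.repr u i * (conj (b.repr v j) * (C p i * conj (C p j))) := by
    intro p
    simp only [Module.Basis.constr_apply_fintype, Module.Basis.equivFun_apply, smul_eq_mul,
      map_sum, map_mul]
    rw [Finset.sum_mul_sum]
    exact Finset.sum_congr rfl fun i _ => Finset.sum_congr rfl fun j _ => by ring
  simp only [hterm, key, Finset.mul_sum]
  conv_rhs => rw [Finset.sum_comm]
  refine Finset.sum_congr rfl fun i _ => ?_
  rw [Finset.sum_comm]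

variable {ι T : Type*} [Fintype ι] [AddCommGroup T] [Module ℂ T]

/-- The form `Σ_{ij} K_{ij}(u_i, v_j)` on `T^ι`. -/
def arrayForm (K : ι → ι → T →ₗ[ℂ] T →ₗ⋆[ℂ] ℂ) : (ι → T) →ₗ[ℂ] (ι → T) →ₗ⋆[ℂ] ℂ :=
  LinearMap.mk₂'ₛₗ (RingHom.id ℂ) (starRingEnd ℂ) (fun u v => ∑ i, ∑ j, K i j (u i) (v j))
    (fun u u' v => by simp [Finset.sum_add_distrib])
    (fun c u v => by simp [Finset.mul_sum])
    (fun u v v' => by simp [Finset.sum_add_distrib])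
    (fun c u v => by simp [Finset.mul_sum])

@[simp]
theorem arrayForm_apply (K : ι → ι → T →ₗ[ℂ] T →ₗ⋆[ℂ] ℂ) (u v : ι → T) :
    arrayForm K u v = ∑ i, ∑ j, K i j (u i) (v j) := rfl

theorem arrayForm_single [DecidableEq ι] (K : ι → ι → T →ₗ[ℂ] T →ₗ⋆[ℂ] ℂ) (i j : ι) (v w : T) :
    arrayForm K (Pi.single i v) (Pi.single j w) = K i j v w := by
  rw [arrayForm_apply, Finset.sum_eq_single i, Finset.sum_eq_single j]
  · simp
  · intro b _ hb; simp [Pi.single_eq_of_ne hb]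
  · simp
  · intro b _ hb; simp [Pi.single_eq_of_ne hb]
  · simp

/-- Positive semidefinite array form on `U^ι`: a factorization through functionals that vanish on
a complement `V^ι`. -/
theorem exists_functionals_of_nonneg_on [FiniteDimensional ℂ T]
    (K : ι → ι → T →ₗ[ℂ] T →ₗ⋆[ℂ] ℂ)
    (hK : ∀ i j v w, conj (K i j v w) = K j i w v) {U V : Submodule ℂ T} (hUV : IsCompl U V)
    (hU : ∀ u : ι → T, (∀ i, u i ∈ U) → 0 ≤ arrayForm K u u) :
    ∃ (N : ℕ) (φ : ι → Fin N → T →ₗ[ℂ] ℂ),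
      (∀ i j, ∀ v ∈ U, ∀ w ∈ U, K i j v w = ∑ p, φ i p v * conj (φ j p w)) ∧
      (∀ i p, ∀ v ∈ V, φ i p v = 0) := by
  classical
  -- Composing with the projection onto `U` along `V` turns non-negativity on U^ι into
  -- non-negativity on all of T^ι.
  let pr : T →ₗ[ℂ] T := U.projection V hUV
  have hpr : ∀ v ∈ U, pr v = v := fun v hv => Submodule.projection_apply_of_mem_left hUV hv
  have hprV : ∀ v ∈ V, pr v = 0 := fun v hv => Submodule.projection_apply_of_mem_right hUV hv
  let K' : ι → ι → T →ₗ[ℂ] T →ₗ⋆[ℂ] ℂ := fun i j =>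
    LinearMap.mk₂'ₛₗ (RingHom.id ℂ) (starRingEnd ℂ) (fun v w => K i j (pr v) (pr w))
      (fun v v' w => by simp) (fun c v w => by simp) (fun v w w' => by simp) (fun c v w => by simp)
  have hK' : ∀ i j v w, K' i j v w = K i j (pr v) (pr w) := fun i j v w => rfl
  obtain ⟨N, φ, hφ⟩ := exists_sum_mul_conj_of_nonneg (arrayForm K') (fun u v => by
      simp only [hK', arrayForm_apply, map_sum, hK]
      rw [Finset.sum_comm])
    (fun u => hU (fun i => pr (u i)) fun i => Submodule.projection_apply_mem hUV _)
  refine ⟨N, fun i p => φ p ∘ₗ LinearMap.single ℂ (fun _ : ι => T) i, ?_, ?_⟩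
  · intro i j v hv w hw
    have := hφ (Pi.single i v) (Pi.single j w)
    rw [arrayForm_single, hK', hpr v hv, hpr w hw] at this
    simpa using this
  -- The pulled-back form vanishes at a vector of `V`, so a sum of squares |φ_p|² is zero there, and
  -- so is each term.
  · intro i p v hv
    have := hφ (Pi.single i v) (Pi.single i v)
    rw [arrayForm_single, hK', hprV v hv] at this
    simp only [map_zero, Complex.mul_conj, ← Complex.ofReal_sum] at this
    have h0 := (Finset.sum_eq_zero_iff_of_nonneg (fun q _ => Complex.normSq_nonneg _)).mp
      (Complex.ofReal_eq_zero.mp this.symm) p (Finset.mem_univ _)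
    simpa using h0

/-- The linear map `T^ι → ℂ^N` with components `u ↦ Σ_i φ_{ip}(u_i)`. -/
def arrayMap {N : ℕ} (φ : ι → Fin N → T →ₗ[ℂ] ℂ) : (ι → T) →ₗ[ℂ] (Fin N → ℂ) :=
  LinearMap.pi fun p => ∑ i, φ i p ∘ₗ LinearMap.proj i

theorem arrayMap_apply {N : ℕ} (φ : ι → Fin N → T →ₗ[ℂ] ℂ) (u : ι → T) (p : Fin N) :
    arrayMap φ u p = ∑ i, φ i p (u i) := by
  simp [arrayMap]

theorem sum_mul_conj_arrayMap {N : ℕ} (φ : ι → Fin N → T →ₗ[ℂ] ℂ) (u v : ι → T) :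
    ∑ i, ∑ j, ∑ p, φ i p (u i) * conj (φ j p (v j)) =
      ∑ p, arrayMap φ u p * conj (arrayMap φ v p) := by
  simp only [arrayMap_apply, map_sum, Finset.sum_mul_sum]
  conv_rhs => rw [Finset.sum_comm]
  refine Finset.sum_congr rfl fun i _ => ?_
  rw [Finset.sum_comm]

theorem sum_mul_conj_nonneg {N : ℕ} (z : Fin N → ℂ) : 0 ≤ ∑ p, z p * conj (z p) :=
  Finset.sum_nonneg fun p _ => by
    rw [Complex.mul_conj]; exact_mod_cast Complex.normSq_nonneg _

theorem sum_mul_conj_pos_iff {N : ℕ} (z : Fin N → ℂ) : 0 < ∑ p, z p * conj (z p) ↔ z ≠ 0 := by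
  rw [(sum_mul_conj_nonneg z).lt_iff_ne, ne_comm, not_iff_not]
  simp only [Complex.mul_conj, ← Complex.ofReal_sum, Complex.ofReal_eq_zero]
  rw [Finset.sum_eq_zero_iff_of_nonneg (fun q _ => Complex.normSq_nonneg _)]
  simp [funext_iff]

/-- The columns are the images of the arrays with a single basis vector in a single slot, and these
arrays span T^ι. -/
theorem rank_eq_finrank_range_arrayMap {n N : ℕ} (b : Module.Basis (Fin n) ℂ T)
    (φ : ι → Fin N → T →ₗ[ℂ] ℂ) :
    (Matrix.of fun (p : Fin N) (q : ι × Fin n) => φ q.1 p (b q.2)).rank =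
      Module.finrank ℂ (LinearMap.range (arrayMap φ)) := by
  classical
  rw [Matrix.rank_eq_finrank_span_cols]
  suffices h : Submodule.span ℂ (Set.range (Matrix.of fun (p : Fin N) (q : ι × Fin n) =>
      φ q.1 p (b q.2)).col) = LinearMap.range (arrayMap φ) by rw [h]
  apply le_antisymm
  · rw [Submodule.span_le]
    rintro _ ⟨q, rfl⟩
    refine ⟨Pi.single q.1 (b q.2), ?_⟩
    ext p
    rw [arrayMap_apply, Finset.sum_eq_single q.1]
    · simp [Matrix.col]
    · intro j _ hj; simp [Pi.single_eq_of_ne hj]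
    · simp
  · rintro _ ⟨u, rfl⟩
    have : arrayMap φ u = ∑ i, ∑ α, b.repr (u i) α •
        (Matrix.of fun (p : Fin N) (q : ι × Fin n) => φ q.1 p (b q.2)).col (i, α) := by
      ext p
      rw [arrayMap_apply]
      simp only [Finset.sum_apply, Pi.smul_apply, Matrix.col, Matrix.transpose_apply,
        Matrix.of_apply, ← map_smul, ← map_sum, b.sum_repr]
    rw [this]
    exact Submodule.sum_mem _ fun i _ => Submodule.sum_mem _ fun α _ =>
      Submodule.smul_mem _ _ (Submodule.subset_span ⟨_, rfl⟩)

theorem finrank_pi_submodule [FiniteDimensional ℂ T] (V : Submodule ℂ T) :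
    Module.finrank ℂ (Submodule.pi Set.univ fun _ : ι => V) =
      Fintype.card ι * Module.finrank ℂ V := by
  have e : (Submodule.pi Set.univ fun _ : ι => V) ≃ₗ[ℂ] (ι → V) :=
    { toFun := fun u i => ⟨u.1 i, u.2 i trivial⟩
      invFun := fun u => ⟨fun i => u i, fun i _ => (u i).2⟩
      map_add' := fun _ _ => rfl
      map_smul' := fun _ _ => rfl
      left_inv := fun _ => rfl
      right_inv := fun _ => rfl }
  rw [e.finrank_eq, Module.finrank_pi_fintype]
  simp

theorem pi_le_ker_arrayMap {N : ℕ} {φ : ι → Fin N → T →ₗ[ℂ] ℂ} {V : Submodule ℂ T}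
    (hφ : ∀ i p, ∀ v ∈ V, φ i p v = 0) :
    (Submodule.pi Set.univ fun _ : ι => V) ≤ LinearMap.ker (arrayMap φ) := by
  intro u hu
  ext p
  rw [arrayMap_apply]
  exact Finset.sum_eq_zero fun i _ => hφ i p _ (hu i trivial)

/-- Rank-nullity with a kernel containing V^ι. It bounds the dimension of a common kernel once the
rank is known. -/
theorem finrank_range_arrayMap_add_le [FiniteDimensional ℂ T] {N : ℕ}
    {φ : ι → Fin N → T →ₗ[ℂ] ℂ} {V : Submodule ℂ T} (hφ : ∀ i p, ∀ v ∈ V, φ i p v = 0) :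
    Module.finrank ℂ (LinearMap.range (arrayMap φ)) + Fintype.card ι * Module.finrank ℂ V ≤
      Fintype.card ι * Module.finrank ℂ T := by
  have h1 := LinearMap.finrank_range_add_finrank_ker (arrayMap φ)
  have h2 := Submodule.finrank_mono (pi_le_ker_arrayMap hφ)
  rw [finrank_pi_submodule] at h2
  rw [Module.finrank_pi_fintype, Finset.sum_const, Finset.card_univ, smul_eq_mul] at h1
  omega

/-- For functionals vanishing on `V`, the rank is maximal exactly when the array map is injective
on `U^ι`, `U` a complement of `V`. -/
theorem finrank_range_arrayMap_eq_iff [FiniteDimensional ℂ T] {N : ℕ}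
    {φ : ι → Fin N → T →ₗ[ℂ] ℂ} {U V : Submodule ℂ T} (hUV : IsCompl U V)
    (hφ : ∀ i p, ∀ v ∈ V, φ i p v = 0) :
    Module.finrank ℂ (LinearMap.range (arrayMap φ)) = Fintype.card ι * Module.finrank ℂ U ↔
      ∀ u : ι → T, (∀ i, u i ∈ U) → arrayMap φ u = 0 → u = 0 := by
  have h1 := LinearMap.finrank_range_add_finrank_ker (arrayMap φ)
  rw [Module.finrank_pi_fintype, Finset.sum_const, Finset.card_univ, smul_eq_mul,
    ← Submodule.finrank_add_eq_of_isCompl hUV, mul_add, ← finrank_pi_submodule V] at h1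
  have hle := pi_le_ker_arrayMap hφ
  constructor
  -- By dimension the kernel is exactly V^ι, which meets U^ι only in zero.
  · intro h u hu hu0
    have h2 : u ∈ Submodule.pi Set.univ fun _ : ι => V := by
      rw [Submodule.eq_of_le_of_finrank_eq hle (by omega)]
      exact hu0
    ext i
    exact Submodule.disjoint_def.mp hUV.disjoint _ (hu i) (h2 i trivial)
  · intro h
    have : (Submodule.pi Set.univ fun _ : ι => V) = LinearMap.ker (arrayMap φ) := by
      refine le_antisymm hle fun u hu => ?_
      have hex : ∀ i, ∃ y ∈ U, ∃ z ∈ V, y + z = u i := fun i =>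
        Submodule.mem_sup.mp (hUV.sup_eq_top ▸ Submodule.mem_top)
      choose y hy z hz hyz using hex
      have hu' : u = y + z := funext fun i => (hyz i).symm
      have hz' : z ∈ Submodule.pi Set.univ fun _ : ι => V := fun i _ => hz i
      have hy0 : y = 0 := h y hy (by
        have := hle hz'
        rw [LinearMap.mem_ker] at this hu
        rwa [hu', map_add, this, add_zero] at hu)
      rw [hu', hy0, zero_add]
      exact hz'
    rw [this] at h1
    omega

/-- A sesquilinear form that is symmetric as a bilinear form over `ℝ` vanishes. -/
theorem sesquilinear_eq_zero_of_swap (D : T →ₗ[ℂ] T →ₗ⋆[ℂ] ℂ) (hD : ∀ v w, D v w = D w v)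
    (v w : T) : D v w = 0 := by
  -- Replacing v by iv multiplies one side by i and the other by -i.
  have h := hD (Complex.I • v) w
  simp only [map_smul, LinearMap.smul_apply, LinearMap.map_smulₛₗ, smul_eq_mul, Complex.conj_I,
    hD w v] at h
  have h2 : (2 * Complex.I) * D v w = 0 := by linear_combination h
  simpa using h2

end LinearAlgebra

/-! ### Wirtinger calculus and the Hermitian symmetry of the curvature -/

section Calculus

open scoped ComplexConjugate

variable {n : ℕ} {f g : Cn n → ℂ} {z : Cn n}

theorem wirtBar_congr (h : f =ᶠ[nhds z] g) (β : Fin n) : wirtBar β f z = wirtBar β g z := by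
  simp only [wirtBar, h.fderiv_eq]

theorem wirtBar_mul (hf : DifferentiableAt ℝ f z) (hg : DifferentiableAt ℝ g z) (β : Fin n) :
    wirtBar β (fun w => f w * g w) z = wirtBar β f z * g z + f z * wirtBar β g z := by
  simp only [wirtBar, fderiv_fun_mul hf hg, add_apply,
    smul_apply, smul_eq_mul]
  ring

theorem wirtBar_sum {κ : Type*} (s : Finset κ) {F : κ → Cn n → ℂ}
    (hF : ∀ k ∈ s, DifferentiableAt ℝ (F k) z) (β : Fin n) :
    wirtBar β (fun w => ∑ k ∈ s, F k w) z = ∑ k ∈ s, wirtBar β (F k) z := by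
  simp only [wirtBar, fderiv_fun_sum hF, sum_apply, Finset.mul_sum,
    ← Finset.sum_add_distrib, Finset.sum_div]

theorem fderiv_conj (v : Cn n) : fderiv ℝ (fun w => conj (f w)) z v = conj (fderiv ℝ f z v) := by
  have h := Complex.conjCLE.comp_fderiv (f := f) (x := z)
  have h2 : (Complex.conjCLE ∘ f) = fun w => conj (f w) := rfl
  rw [h2] at h
  rw [h]
  simp

theorem conj_wirt (α : Fin n) : conj (wirt α f z) = wirtBar α (fun w => conj (f w)) z := by
  simp only [wirt, wirtBar, fderiv_conj, map_div₀, map_sub, map_mul, Complex.conj_I, map_ofNat]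
  ring

theorem conj_wirtBar (α : Fin n) : conj (wirtBar α f z) = wirt α (fun w => conj (f w)) z := by
  simp only [wirt, wirtBar, fderiv_conj, map_div₀, map_add, map_mul, Complex.conj_I, map_ofNat]
  ring

theorem differentiableAt_fderiv_apply (hf : ContDiffAt ℝ 2 f z) (v : Cn n) :
    DifferentiableAt ℝ (fun w => fderiv ℝ f w v) z :=
  ((hf.fderiv_right (m := 1) (by norm_num)).differentiableAt (by norm_num)).clm_apply
    (differentiableAt_const v)

theorem fderiv_fderiv_apply (hf : ContDiffAt ℝ 2 f z) (u v : Cn n) :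
    fderiv ℝ (fun w => fderiv ℝ f w v) z u = fderiv ℝ (fderiv ℝ f) z u v := by
  rw [fderiv_clm_apply
    ((hf.fderiv_right (m := 1) (by norm_num)).differentiableAt (by norm_num))
    (differentiableAt_const v)]
  simp

theorem differentiableAt_wirt (hf : ContDiffAt ℝ 2 f z) (α : Fin n) :
    DifferentiableAt ℝ (wirt α f) z := by
  have h1 := differentiableAt_fderiv_apply hf (stdVec α)
  have h2 := differentiableAt_fderiv_apply hf (Complex.I • stdVec α)
  exact (h1.sub (h2.const_mul Complex.I)).mul_const (2 : ℂ)⁻¹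

theorem wirtBar_wirt_comm (hf : ContDiffAt ℝ 2 f z) (α β : Fin n) :
    wirtBar β (wirt α f) z = wirt α (wirtBar β f) z := by
  -- The values s = -i and s = i give the two Wirtinger operators; what remains is the symmetry of
  -- the second real derivative.
  have key : ∀ (s : ℂ) (a v : Cn n), fderiv ℝ (fun w => (fderiv ℝ f w a +
      s * fderiv ℝ f w (Complex.I • a)) / 2) z v = (fderiv ℝ (fderiv ℝ f) z v a +
      s * fderiv ℝ (fderiv ℝ f) z v (Complex.I • a)) / 2 := by
    intro s a v
    have h1 := differentiableAt_fderiv_apply hf a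
    have h2 := differentiableAt_fderiv_apply hf (Complex.I • a)
    have h3 := ((h1.hasFDerivAt.add (h2.hasFDerivAt.const_mul s)).mul_const (2⁻¹ : ℂ)).fderiv
    simp only [div_eq_mul_inv]
    erw [h3]
    simp [fderiv_fderiv_apply hf]
    ring
  have hw : wirt α f = fun w => (fderiv ℝ f w (stdVec α) +
      (-Complex.I) * fderiv ℝ f w (Complex.I • stdVec α)) / 2 := by
    funext w
    rw [wirt]
    ring
  have hs := hf.isSymmSndFDerivAt (by simp)
  rw [wirt, wirtBar, hw]
  unfold wirtBar
  rw [key, key, key, key, hs.eq (stdVec β), hs.eq (stdVec β), hs.eq (Complex.I • stdVec β),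
    hs.eq (Complex.I • stdVec β)]
  ring

theorem differentiableAt_det {m : ℕ} {M : Cn n → Matrix (Fin m) (Fin m) ℂ}
    (hM : ∀ i j, DifferentiableAt ℝ (fun w => M w i j) z) :
    DifferentiableAt ℝ (fun w => (M w).det) z := by
  simp only [Matrix.det_apply']
  exact DifferentiableAt.fun_sum fun σ _ =>
    (HasFDerivAt.finsetProd fun i _ => (hM _ _).hasFDerivAt).differentiableAt.const_mul _

theorem differentiableAt_matrix_inv {m : ℕ} {M : Cn n → Matrix (Fin m) (Fin m) ℂ}
    (hM : ∀ i j, DifferentiableAt ℝ (fun w => M w i j) z) (hdet : (M z).det ≠ 0) (i j : Fin m) :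
    DifferentiableAt ℝ (fun w => (M w)⁻¹ i j) z := by
  simp only [Matrix.inv_def, Matrix.smul_apply, Matrix.adjugate_apply, smul_eq_mul,
    Ring.inverse_eq_inv']
  refine ((differentiableAt_det hM).inv hdet).mul (differentiableAt_det fun k l => ?_)
  rcases eq_or_ne k j with rfl | h
  · simp
  · simpa [Matrix.updateRow_ne h] using hM k l

variable {r : ℕ} {H : Cn n → Matrix (Fin r) (Fin r) ℂ}

/-- The covariant curvature `R_{αβ̄} h = -∂_α∂̄_β h + ∂_α h · h⁻¹ · ∂̄_β h`. -/
theorem sum_curvatureMatrix_mul (hC : ∀ i k, ContDiffAt ℝ 2 (fun w => H w i k) z)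
    (hdet : (H z).det ≠ 0) (i j : Fin r) (α β : Fin n) :
    ∑ k, curvatureMatrix H α β z k i * H z k j =
      -wirtBar β (wirt α fun w => H w i j) z +
        (Matrix.of (fun i k => wirt α (fun w => H w i k) z) * (H z)⁻¹ *
          Matrix.of fun i k => wirtBar β (fun w => H w i k) z) i j := by
  have hD : ∀ i k, DifferentiableAt ℝ (fun w => H w i k) z :=
    fun i k => (hC i k).differentiableAt (by norm_num)
  have hθ : ∀ k, DifferentiableAt ℝ (fun w => connectionForm H α w k i) z := by
    intro k
    simp only [connectionForm, Matrix.transpose_apply, Matrix.mul_apply, Matrix.of_apply]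
    exact DifferentiableAt.fun_sum fun l _ =>
      (differentiableAt_wirt (hC i l) α).mul (differentiableAt_matrix_inv hD hdet l k)
  -- The identity θᵀ h = ∂h holds wherever `H` is invertible, hence near `z`, and may be
  -- differentiated by ∂̄_β. This gives the formula without differentiating h⁻¹.
  have hev : (fun w => ∑ k, connectionForm H α w k i * H w k j) =ᶠ[nhds z]
      wirt α fun w => H w i j := by
    filter_upwards [(differentiableAt_det hD).continuousAt.eventually_ne hdet] with w hw
    have h := Matrix.nonsing_inv_mul_cancel_right (H w)
      (Matrix.of fun i k => wirt α (fun w => H w i k) w) (isUnit_iff_ne_zero.mpr hw)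
    exact congrFun (congrFun h i) j
  have h := wirtBar_congr hev β
  rw [wirtBar_sum _ fun k _ => (hθ k).fun_mul (hD k j)] at h
  simp only [wirtBar_mul (hθ _) (hD _ j), Finset.sum_add_distrib] at h
  rw [← h, Matrix.mul_apply]
  simp only [curvatureMatrix, Matrix.of_apply, neg_mul, Finset.sum_neg_distrib]
  simp only [connectionForm, Matrix.transpose_apply]
  ring

/-- Conjugate transposition exchanges ∂_γ h and ∂̄_γ h. The second-order term is then symmetric
because ∂ and ∂̄ commute, the other because it has the shape P_α h⁻¹ P_β*. -/
theorem conj_sum_curvatureMatrix_mul (hC : ∀ i k, ContDiffAt ℝ 2 (fun w => H w i k) z)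
    (hH : ∀ w i k, conj (H w i k) = H w k i) (hdet : (H z).det ≠ 0) (i j : Fin r)
    (α β : Fin n) :
    conj (∑ k, curvatureMatrix H α β z k i * H z k j) =
      ∑ k, curvatureMatrix H β α z k j * H z k i := by
  rw [sum_curvatureMatrix_mul hC hdet, sum_curvatureMatrix_mul hC hdet, map_add, map_neg,
    conj_wirtBar]
  have h1 : (fun w => conj (wirt α (fun w => H w i j) w)) = wirtBar α fun w => H w j i := by
    funext w
    simp only [conj_wirt, hH]
  rw [h1, ← wirtBar_wirt_comm (hC j i)]
  congr 1
  have hHz : (H z).conjTranspose = H z := by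
    ext i k
    exact hH z k i
  have e1 : ∀ γ, (Matrix.of fun i k => wirt γ (fun w => H w i k) z).conjTranspose =
      Matrix.of fun i k => wirtBar γ (fun w => H w i k) z := by
    intro γ
    ext i k
    simp only [Matrix.conjTranspose_apply, Matrix.of_apply, RCLike.star_def, conj_wirt, hH]
  have e2 : ∀ γ, (Matrix.of fun i k => wirtBar γ (fun w => H w i k) z).conjTranspose =
      Matrix.of fun i k => wirt γ (fun w => H w i k) z := by
    intro γ
    rw [← e1, Matrix.conjTranspose_conjTranspose]
  have h2 : (Matrix.of (fun i k => wirt α (fun w => H w i k) z) * (H z)⁻¹ *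
      Matrix.of fun i k => wirtBar β (fun w => H w i k) z).conjTranspose =
      Matrix.of (fun i k => wirt β (fun w => H w i k) z) * (H z)⁻¹ *
      Matrix.of fun i k => wirtBar α (fun w => H w i k) z := by
    rw [Matrix.conjTranspose_mul, Matrix.conjTranspose_mul, e1, e2,
      Matrix.conjTranspose_nonsing_inv, hHz, Matrix.mul_assoc]
  exact congrFun (congrFun h2 j) i

end Calculus

/-! ### Type I decompositions and sums of squares -/

section Decomposition

open scoped ComplexConjugate

variable {ι T : Type*} [AddCommGroup T] [Module ℂ T]

/-- `K` is the sum of a Nakano square and a dual Nakano square. -/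
def IsSumOfSquares {N₁ N₂ : ℕ} (K : ι → ι → T →ₗ[ℂ] T →ₗ⋆[ℂ] ℂ) (φ : ι → Fin N₂ → T →ₗ[ℂ] ℂ)
    (ψ : ι → Fin N₁ → T →ₗ[ℂ] ℂ) : Prop :=
  ∀ i j v w, K i j v w = ∑ p, φ i p v * conj (φ j p w) + ∑ p, ψ j p v * conj (ψ i p w)

/-- Exchanging the frame indices exchanges the Nakano and dual Nakano squares, so every dual
statement is the Nakano one for the swapped array. -/
theorem IsSumOfSquares.swap {K : ι → ι → T →ₗ[ℂ] T →ₗ⋆[ℂ] ℂ} {N₁ N₂ : ℕ}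
    {φ : ι → Fin N₂ → T →ₗ[ℂ] ℂ} {ψ : ι → Fin N₁ → T →ₗ[ℂ] ℂ} (h : IsSumOfSquares K φ ψ) :
    IsSumOfSquares (fun i j => K j i) ψ φ :=
  fun i j v w => by rw [h, add_comm]

/-- The span of an array of functionals. -/
def arraySpan {N : ℕ} (φ : ι → Fin N → T →ₗ[ℂ] ℂ) : Submodule ℂ (Module.Dual ℂ T) :=
  Submodule.span ℂ (Set.range fun q : ι × Fin N => φ q.1 q.2)

theorem apply_eq_zero_of_mem_dualCoannihilator {N : ℕ} (φ : ι → Fin N → T →ₗ[ℂ] ℂ) (i : ι)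
    (p : Fin N) (v : T) (hv : v ∈ (arraySpan φ).dualCoannihilator) : φ i p v = 0 :=
  (Submodule.mem_dualCoannihilator v).mp hv _ (Submodule.subset_span ⟨(i, p), rfl⟩)

/-- The spans lie in the annihilators of `V` and `U`, whose intersection annihilates U + V. -/
theorem arraySpan_inf_eq_bot {N₁ N₂ : ℕ} {φ : ι → Fin N₂ → T →ₗ[ℂ] ℂ}
    {ψ : ι → Fin N₁ → T →ₗ[ℂ] ℂ} {U V : Submodule ℂ T} (hUV : IsCompl U V)
    (hφ : ∀ i p, ∀ v ∈ V, φ i p v = 0) (hψ : ∀ i p, ∀ u ∈ U, ψ i p u = 0) :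
    arraySpan φ ⊓ arraySpan ψ = ⊥ := by
  have h1 : arraySpan φ ≤ V.dualAnnihilator := by
    refine Submodule.span_le.mpr ?_
    rintro _ ⟨q, rfl⟩
    exact (Submodule.mem_dualAnnihilator _).mpr (hφ q.1 q.2)
  have h2 : arraySpan ψ ≤ U.dualAnnihilator := by
    refine Submodule.span_le.mpr ?_
    rintro _ ⟨q, rfl⟩
    exact (Submodule.mem_dualAnnihilator _).mpr (hψ q.1 q.2)
  rw [eq_bot_iff]
  refine (inf_le_inf h1 h2).trans ?_
  rw [← Submodule.dualAnnihilator_sup_eq, hUV.symm.sup_eq_top, Submodule.dualAnnihilator_top]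

/-- The dual form of (2): the annihilator of the sum of the two common kernels is `S' ⊓ S`, so that
sum is everything. -/
theorem dualCoannihilator_sup_eq_top [FiniteDimensional ℂ T]
    {S S' : Submodule ℂ (Module.Dual ℂ T)} (h : S ⊓ S' = ⊥) :
    S'.dualCoannihilator ⊔ S.dualCoannihilator = ⊤ := by
  rw [← Subspace.dualAnnihilator_dualCoannihilator_eq
    (W := S'.dualCoannihilator ⊔ S.dualCoannihilator), Submodule.dualAnnihilator_sup_eq,
    Subspace.dualCoannihilator_dualAnnihilator_eq, Subspace.dualCoannihilator_dualAnnihilator_eq,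
    inf_comm, h, Submodule.dualCoannihilator_bot]

variable [Fintype ι]

/-- The three non-negativity conditions of type I for the form `K` and the subspaces `U`, `V`. -/
def IsNonnegDecomposition (K : ι → ι → T →ₗ[ℂ] T →ₗ⋆[ℂ] ℂ) (U V : Submodule ℂ T) : Prop :=
  (∀ u : ι → T, (∀ i, u i ∈ U) → u ≠ 0 → 0 ≤ arrayForm K u u) ∧
  (∀ u v : ι → T, (∀ i, u i ∈ U) → (∀ i, v i ∈ V) → arrayForm K u v = 0) ∧
  (∀ v : ι → T, (∀ i, v i ∈ V) → v ≠ 0 → 0 ≤ arrayForm (fun i j => K j i) v v)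

/-- The three positivity conditions of type I for the form `K` and the subspaces `U`, `V`. -/
def IsPosDecomposition (K : ι → ι → T →ₗ[ℂ] T →ₗ⋆[ℂ] ℂ) (U V : Submodule ℂ T) : Prop :=
  (∀ u : ι → T, (∀ i, u i ∈ U) → u ≠ 0 → 0 < arrayForm K u u) ∧
  (∀ u v : ι → T, (∀ i, u i ∈ U) → (∀ i, v i ∈ V) → arrayForm K u v = 0) ∧
  (∀ v : ι → T, (∀ i, v i ∈ V) → v ≠ 0 → 0 < arrayForm (fun i j => K j i) v v)

theorem IsPosDecomposition.isNonnegDecomposition {K : ι → ι → T →ₗ[ℂ] T →ₗ⋆[ℂ] ℂ}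
    {U V : Submodule ℂ T} (h : IsPosDecomposition K U V) : IsNonnegDecomposition K U V :=
  ⟨fun u hu h0 => (h.1 u hu h0).le, h.2.1, fun v hv h0 => (h.2.2 v hv h0).le⟩

theorem IsNonnegDecomposition.exists_isSumOfSquares [FiniteDimensional ℂ T]
    {K : ι → ι → T →ₗ[ℂ] T →ₗ⋆[ℂ] ℂ} {U V : Submodule ℂ T} (hUV : IsCompl U V)
    (hK : ∀ i j v w, conj (K i j v w) = K j i w v) (h : IsNonnegDecomposition K U V) :
    ∃ (N₁ N₂ : ℕ) (φ : ι → Fin N₂ → T →ₗ[ℂ] ℂ) (ψ : ι → Fin N₁ → T →ₗ[ℂ] ℂ),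
      IsSumOfSquares K φ ψ ∧ (∀ i p, ∀ v ∈ V, φ i p v = 0) ∧ ∀ i p, ∀ u ∈ U, ψ i p u = 0 := by
  classical
  obtain ⟨N₂, φ, hφ, hφV⟩ := exists_functionals_of_nonneg_on K hK hUV fun u hu => by
    rcases eq_or_ne u 0 with rfl | h0
    · simp
    · exact h.1 u hu h0
  obtain ⟨N₁, ψ, hψ, hψU⟩ := exists_functionals_of_nonneg_on (fun i j => K j i)
    (fun i j v w => hK j i v w) hUV.symm fun u hu => by
      rcases eq_or_ne u 0 with rfl | h0
      · simp
      · exact h.2.2 u hu h0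
  refine ⟨N₁, N₂, φ, ψ, fun i j v w => ?_, hφV, hψU⟩
  have hcross : ∀ i j, ∀ u ∈ U, ∀ v ∈ V, K i j u v = 0 := by
    intro i j u hu v hv
    rw [← arrayForm_single K]
    refine h.2.1 _ _ (fun k => ?_) (fun k => ?_)
    · rcases eq_or_ne k i with rfl | hk
      · simpa
      · simp [Pi.single_eq_of_ne hk]
    · rcases eq_or_ne k j with rfl | hk
      · simpa
      · simp [Pi.single_eq_of_ne hk]
  -- Only the U × V block is assumed to vanish; the V × U block follows by Hermitian symmetry.
  have hcross' : ∀ i j, ∀ v ∈ V, ∀ u ∈ U, K i j v u = 0 := by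
    intro i j v hv u hu
    rw [← hK, hcross j i u hu v hv, map_zero]
  obtain ⟨v₁, hv₁, v₂, hv₂, rfl⟩ : ∃ y ∈ U, ∃ z ∈ V, y + z = v :=
    Submodule.mem_sup.mp (hUV.sup_eq_top ▸ Submodule.mem_top)
  obtain ⟨w₁, hw₁, w₂, hw₂, rfl⟩ : ∃ y ∈ U, ∃ z ∈ V, y + z = w :=
    Submodule.mem_sup.mp (hUV.sup_eq_top ▸ Submodule.mem_top)
  simp only [map_add, LinearMap.add_apply, hcross _ _ v₁ hv₁ w₂ hw₂,
    hcross' _ _ v₂ hv₂ w₁ hw₁, hφ i j v₁ hv₁ w₁ hw₁, hφV _ _ v₂ hv₂, hφV _ _ w₂ hw₂,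
    hψU _ _ v₁ hv₁, hψU _ _ w₁ hw₁, add_zero, zero_add]
  rw [hψ j i v₂ hv₂ w₂ hw₂]

namespace IsSumOfSquares

variable {K : ι → ι → T →ₗ[ℂ] T →ₗ⋆[ℂ] ℂ} {N₁ N₂ : ℕ} {φ : ι → Fin N₂ → T →ₗ[ℂ] ℂ}
  {ψ : ι → Fin N₁ → T →ₗ[ℂ] ℂ} {U V : Submodule ℂ T}

/-- In the dual square, ψ is applied to the entries of `u`, so it drops out without any condition on
`v`. One formula thus serves both the definiteness on U^ι and the vanishing of the mixed terms. -/
theorem arrayForm_eq (h : IsSumOfSquares K φ ψ) (hψ : ∀ i p, ∀ u ∈ U, ψ i p u = 0) {u : ι → T}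
    (hu : ∀ i, u i ∈ U) (v : ι → T) :
    arrayForm K u v = ∑ p, arrayMap φ u p * conj (arrayMap φ v p) := by
  rw [← sum_mul_conj_arrayMap, arrayForm_apply]
  refine Finset.sum_congr rfl fun i _ => Finset.sum_congr rfl fun j _ => ?_
  simp [h i j, hψ _ _ _ (hu i)]

theorem isNonnegDecomposition (h : IsSumOfSquares K φ ψ) (hφ : ∀ i p, ∀ v ∈ V, φ i p v = 0)
    (hψ : ∀ i p, ∀ u ∈ U, ψ i p u = 0) : IsNonnegDecomposition K U V := by
  refine ⟨fun u hu _ => ?_, fun u v hu hv => ?_, fun v hv _ => ?_⟩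
  · rw [h.arrayForm_eq hψ hu]
    exact sum_mul_conj_nonneg _
  · rw [h.arrayForm_eq hψ hu]
    have : arrayMap φ v = 0 := pi_le_ker_arrayMap hφ fun i _ => hv i
    simp [this]
  · rw [h.swap.arrayForm_eq hφ hv]
    exact sum_mul_conj_nonneg _

theorem isPosDecomposition_iff [FiniteDimensional ℂ T] (h : IsSumOfSquares K φ ψ)
    (hUV : IsCompl U V) (hφ : ∀ i p, ∀ v ∈ V, φ i p v = 0) (hψ : ∀ i p, ∀ u ∈ U, ψ i p u = 0) :
    IsPosDecomposition K U V ↔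
      Module.finrank ℂ (LinearMap.range (arrayMap ψ)) = Fintype.card ι * Module.finrank ℂ V ∧
      Module.finrank ℂ (LinearMap.range (arrayMap φ)) = Fintype.card ι * Module.finrank ℂ U := by
  rw [finrank_range_arrayMap_eq_iff hUV hφ, finrank_range_arrayMap_eq_iff hUV.symm hψ]
  constructor
  · refine fun hp => ⟨fun v hv h0 => ?_, fun u hu h0 => ?_⟩
    · by_contra hne
      have := hp.2.2 v hv hne
      rw [h.swap.arrayForm_eq hφ hv, sum_mul_conj_pos_iff] at this
      exact this h0
    · by_contra hne
      have := hp.1 u hu hne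
      rw [h.arrayForm_eq hψ hu, sum_mul_conj_pos_iff] at this
      exact this h0
  · refine fun hp => ⟨fun u hu hne => ?_, (h.isNonnegDecomposition hφ hψ).2.1, fun v hv hne => ?_⟩
    · rw [h.arrayForm_eq hψ hu, sum_mul_conj_pos_iff]
      exact fun h0 => hne (hp.2 u hu h0)
    · rw [h.swap.arrayForm_eq hφ hv, sum_mul_conj_pos_iff]
      exact fun h0 => hne (hp.1 v hv h0)

end IsSumOfSquares

theorem IsSumOfSquares.exists_isNonnegDecomposition [FiniteDimensional ℂ T]
    {K : ι → ι → T →ₗ[ℂ] T →ₗ⋆[ℂ] ℂ} {N₁ N₂ : ℕ} {φ : ι → Fin N₂ → T →ₗ[ℂ] ℂ}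
    {ψ : ι → Fin N₁ → T →ₗ[ℂ] ℂ} (h : IsSumOfSquares K φ ψ)
    (hspan : arraySpan φ ⊓ arraySpan ψ = ⊥) :
    ∃ U V : Submodule ℂ T, IsCompl U V ∧ IsNonnegDecomposition K U V := by
  -- The common kernels span `T` but may overlap; ψ still vanishes on the smaller `U`.
  obtain ⟨U, hU, hUV⟩ :=
    (codisjoint_iff.mpr (dualCoannihilator_sup_eq_top hspan)).exists_isCompl
  exact ⟨U, _, hUV, h.isNonnegDecomposition
    (apply_eq_zero_of_mem_dualCoannihilator φ)
    fun i p u hu => apply_eq_zero_of_mem_dualCoannihilator ψ i p u (hU hu)⟩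

/-- The given `U` and `V` contribute only their dimensions. The ranks force dim U' ≤ dim U and dim
V' ≤ dim V for the common kernels U' of ψ and V' of φ; since U' + V' = T, both are equalities and
the sum is direct. -/
theorem IsSumOfSquares.exists_isPosDecomposition [FiniteDimensional ℂ T]
    {K : ι → ι → T →ₗ[ℂ] T →ₗ⋆[ℂ] ℂ} {N₁ N₂ : ℕ} {φ : ι → Fin N₂ → T →ₗ[ℂ] ℂ}
    {ψ : ι → Fin N₁ → T →ₗ[ℂ] ℂ} (h : IsSumOfSquares K φ ψ)
    (hspan : arraySpan φ ⊓ arraySpan ψ = ⊥) {U V : Submodule ℂ T} (hUV : IsCompl U V)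
    (hψV : Module.finrank ℂ (LinearMap.range (arrayMap ψ)) =
      Fintype.card ι * Module.finrank ℂ V)
    (hφU : Module.finrank ℂ (LinearMap.range (arrayMap φ)) =
      Fintype.card ι * Module.finrank ℂ U) :
    ∃ U V : Submodule ℂ T, IsCompl U V ∧ IsPosDecomposition K U V := by
  -- In rank zero the factor r cannot be cancelled, but there are no non-zero arrays, so the given
  -- pair works.
  rcases isEmpty_or_nonempty ι with hι | hι
  · exact ⟨U, V, hUV, fun u _ h0 => (h0 (Subsingleton.elim _ _)).elim, fun u v _ _ => by simp,
      fun u _ h0 => (h0 (Subsingleton.elim _ _)).elim⟩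
  have hφ := apply_eq_zero_of_mem_dualCoannihilator φ
  have hψ := apply_eq_zero_of_mem_dualCoannihilator ψ
  set U' := (arraySpan ψ).dualCoannihilator
  set V' := (arraySpan φ).dualCoannihilator
  have hr : 0 < Fintype.card ι := Fintype.card_pos
  have h1 := finrank_range_arrayMap_add_le hφ
  have h2 := finrank_range_arrayMap_add_le hψ
  rw [hφU, ← mul_add] at h1
  rw [hψV, ← mul_add] at h2
  have h1' := Nat.le_of_mul_le_mul_left h1 hr
  have h2' := Nat.le_of_mul_le_mul_left h2 hr
  have hsum := Submodule.finrank_add_eq_of_isCompl hUV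
  have hsup : U' ⊔ V' = ⊤ := dualCoannihilator_sup_eq_top hspan
  have hdim := Submodule.finrank_sup_add_finrank_inf_eq U' V'
  rw [hsup, finrank_top] at hdim
  have hUV' : IsCompl U' V' :=
    ⟨disjoint_iff.mpr (Submodule.finrank_eq_zero.mp (by omega)), codisjoint_iff.mpr hsup⟩
  refine ⟨U', V', hUV', (h.isPosDecomposition_iff hUV' hφ hψ).mpr ⟨?_, ?_⟩⟩
  · rw [hψV]
    congr 1
    omega
  · rw [hφU]
    congr 1
    omega

/-- The action of a matrix on arrays of vectors. -/
def arrayAct (P : Matrix ι ι ℂ) (u : ι → T) (a : ι) : T := ∑ i, P a i • u i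

theorem arrayAct_mem {P : Matrix ι ι ℂ} {u : ι → T} {U : Submodule ℂ T} (hu : ∀ i, u i ∈ U)
    (a : ι) : arrayAct P u a ∈ U :=
  Submodule.sum_mem _ fun i _ => Submodule.smul_mem _ _ (hu i)

theorem arrayAct_ne_zero [DecidableEq ι] {P Q : Matrix ι ι ℂ} (hQP : Q * P = 1) {u : ι → T}
    (hu : u ≠ 0) : arrayAct P u ≠ 0 := by
  contrapose! hu
  have h1 : arrayAct Q (arrayAct P u) = u := by
    ext a
    simp only [arrayAct, Finset.smul_sum, smul_smul]
    rw [Finset.sum_comm]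
    simp only [← Finset.sum_smul, ← Matrix.mul_apply, hQP, Matrix.one_apply, ite_smul, one_smul,
      zero_smul, Finset.sum_ite_eq, Finset.mem_univ, if_true]
  rw [← h1, hu]
  ext a
  simp [arrayAct]

/-- Two arrays of forms that are related by a change of frame. -/
def IsFrameChange (K K' : ι → ι → T →ₗ[ℂ] T →ₗ⋆[ℂ] ℂ) (P : Matrix ι ι ℂ) : Prop :=
  ∀ i j v w, K i j v w = ∑ a, ∑ b, P a i * conj (P b j) * K' a b v w

theorem IsFrameChange.arrayForm_eq {K K' : ι → ι → T →ₗ[ℂ] T →ₗ⋆[ℂ] ℂ} {P : Matrix ι ι ℂ}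
    (h : IsFrameChange K K' P) (u v : ι → T) :
    arrayForm K u v = arrayForm K' (arrayAct P u) (arrayAct P v) := by
  simp only [arrayForm_apply, arrayAct, map_sum, LinearMap.sum_apply, LinearMap.map_smulₛₗ,
    LinearMap.smul_apply, smul_eq_mul, h _ _ _ _, RingHom.id_apply]
  rw [Finset.sum_congr rfl fun i _ => Finset.sum_comm, Finset.sum_comm]
  refine Finset.sum_congr rfl fun a _ => ?_
  rw [Finset.sum_congr rfl fun i _ => Finset.sum_comm, Finset.sum_comm]
  refine Finset.sum_congr rfl fun b _ => ?_
  rw [Finset.sum_comm]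
  refine Finset.sum_congr rfl fun i _ => ?_
  simp only [Finset.mul_sum]
  refine Finset.sum_congr rfl fun j _ => ?_
  ring

/-- The dual form lives on the conjugate bundle, so it transforms by the conjugate matrix. -/
theorem IsFrameChange.swap {K K' : ι → ι → T →ₗ[ℂ] T →ₗ⋆[ℂ] ℂ} {P : Matrix ι ι ℂ}
    (h : IsFrameChange K K' P) :
    IsFrameChange (fun i j => K j i) (fun i j => K' j i) (P.map conj) := by
  intro i j v w
  rw [h j i, Finset.sum_comm]
  refine Finset.sum_congr rfl fun a _ => Finset.sum_congr rfl fun b _ => ?_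
  simp only [Matrix.map_apply, Complex.conj_conj]
  ring

/-- The matrix mixes only the frame index, so it preserves U^ι and V^ι, and it is injective; the
same `U` and `V` therefore work. -/
theorem IsFrameChange.isNonnegDecomposition [DecidableEq ι] {K K' : ι → ι → T →ₗ[ℂ] T →ₗ⋆[ℂ] ℂ}
    {P Q : Matrix ι ι ℂ} (h : IsFrameChange K K' P) (hQP : Q * P = 1) {U V : Submodule ℂ T}
    (hK : IsNonnegDecomposition K' U V) : IsNonnegDecomposition K U V := by
  have hQP' : Q.map conj * P.map conj = 1 := by
    rw [← Matrix.map_mul, hQP, Matrix.map_one _ (map_zero _) (map_one _)]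
  refine ⟨fun u hu h0 => ?_, fun u v hu hv => ?_, fun v hv h0 => ?_⟩
  · rw [h.arrayForm_eq]
    exact hK.1 _ (arrayAct_mem hu) (arrayAct_ne_zero hQP h0)
  · rw [h.arrayForm_eq]
    exact hK.2.1 _ _ (arrayAct_mem hu) (arrayAct_mem hv)
  · rw [h.swap.arrayForm_eq]
    exact hK.2.2 _ (arrayAct_mem hv) (arrayAct_ne_zero hQP' h0)

theorem IsFrameChange.isPosDecomposition [DecidableEq ι] {K K' : ι → ι → T →ₗ[ℂ] T →ₗ⋆[ℂ] ℂ}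
    {P Q : Matrix ι ι ℂ} (h : IsFrameChange K K' P) (hQP : Q * P = 1) {U V : Submodule ℂ T}
    (hK : IsPosDecomposition K' U V) : IsPosDecomposition K U V := by
  have hQP' : Q.map conj * P.map conj = 1 := by
    rw [← Matrix.map_mul, hQP, Matrix.map_one _ (map_zero _) (map_one _)]
  refine ⟨fun u hu h0 => ?_, fun u v hu hv => ?_, fun v hv h0 => ?_⟩
  · rw [h.arrayForm_eq]
    exact hK.1 _ (arrayAct_mem hu) (arrayAct_ne_zero hQP h0)
  · rw [h.arrayForm_eq]
    exact hK.2.1 _ _ (arrayAct_mem hu) (arrayAct_mem hv)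
  · rw [h.swap.arrayForm_eq]
    exact hK.2.2 _ (arrayAct_mem hv) (arrayAct_ne_zero hQP' h0)

end Decomposition

/-- Every positive definite Hermitian form has a unitary basis. -/
theorem exists_unitary_basis {F : Type*} [AddCommGroup F] [Module ℂ F] {r : ℕ}
    [FiniteDimensional ℂ F] (hr : Module.finrank ℂ F = r) (q : F →ₗ[ℂ] F →ₗ⋆[ℂ] ℂ)
    (hsymm : ∀ v w, starRingEnd ℂ (q v w) = q w v) (hpos : ∀ v, v ≠ 0 → 0 < q v v) :
    ∃ e : Module.Basis (Fin r) ℂ F, ∀ i j, q (e i) (e j) = if i = j then 1 else 0 := by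
  let c : InnerProductSpace.Core ℂ F :=
    -- The arguments are swapped because an inner product is conjugate linear in its first variable.
    { inner := fun v w => q w v
      conj_inner_symm := fun v w => hsymm v w
      re_inner_nonneg := fun v => by
        rcases eq_or_ne v 0 with rfl | h
        · simp
        · exact (Complex.pos_iff.mp (hpos v h)).1.le
      add_left := fun u v w => by simp
      smul_left := fun u v c => by simp
      definite := fun v h => by
        by_contra h0
        exact (hpos v h0).ne' h }
  let _ : NormedAddCommGroup F := c.toNormedAddCommGroup
  let _ : InnerProductSpace ℂ F := InnerProductSpace.ofCore c.toCore
  let e := (stdOrthonormalBasis ℂ F).reindex (finCongr hr)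
  refine ⟨e.toBasis, fun i j => ?_⟩
  have := orthonormal_iff_ite.mp e.orthonormal j i
  simp only [OrthonormalBasis.coe_toBasis]
  simp only [eq_comm (a := i)]
  exact this

/-! ### The Chern curvature as a Hermitian array of forms -/

section Curvature

open scoped ComplexConjugate

variable {n r : ℕ} {X : Type*} [TopologicalSpace X] [ChartedSpace (Cn n) X]

instance (x : X) : FiniteDimensional ℂ (HolTangent n x) :=
  inferInstanceAs (FiniteDimensional ℂ (Cn n))

/-- The coordinate basis `∂_1, …, ∂_n` of the holomorphic tangent space. -/
def tangentBasis (x : X) : Module.Basis (Fin n) ℂ (HolTangent n x) :=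
  (EuclideanSpace.basisFun (Fin n) ℂ).toBasis

theorem tangentBasis_apply (x : X) (α : Fin n) : tangentBasis x α = tangentVec x α := by
  change (EuclideanSpace.basisFun (Fin n) ℂ).toBasis α = stdVec α
  simp [stdVec]

theorem dz_sum_tangentVec (x : X) (c : Fin n → ℂ) (β : Fin n) :
    dz x β (∑ α, c α • tangentVec x α) = c β := by
  have h : ∀ α, dz x β (tangentVec x α) = if β = α then 1 else 0 := by
    intro α
    change (stdVec α : Cn n) β = _
    simp [stdVec]
  rw [map_sum]
  simp [h]

theorem sum_dz_tangentVec (x : X) (v : HolTangent n x) :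
    ∑ α, dz x α v • tangentVec x α = v := by
  have h := (tangentBasis x).sum_repr v
  simp only [tangentBasis_apply] at h
  exact h

variable {E : X → Type*} [TopologicalSpace (TotalSpace (Cn r) E)]
  [∀ x, AddCommGroup (E x)] [∀ x, Module ℂ (E x)] [∀ x, TopologicalSpace (E x)]
  [FiberBundle (Cn r) E] [VectorBundle ℂ (Cn r) E]

theorem metricMatrix_chartAt (h : HermitianMetric n r E) (x : X) (i k : Fin r) :
    metricMatrix h x (chartAt (Cn n) x x) i k =
      h.form x (frameBasis E x i) (frameBasis E x k) := by
  -- The chart and its inverse return to `x` only up to a propositional equality on which the fibre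
  -- depends, hence the general `y`.
  have key : ∀ y, y = x → h.form y (localFrame E x i y) (localFrame E x k y) =
      h.form x (frameBasis E x i) (frameBasis E x k) := by
    rintro y rfl
    rw [frameBasis_apply, frameBasis_apply]
  exact key _ ((chartAt (Cn n) x).left_inv (mem_chart_source _ x))

theorem contDiffAt_metricMatrix (h : HermitianMetric n r E) (x : X) (i k : Fin r) :
    ContDiffAt ℝ 2 (fun z => metricMatrix h x z i k) (chartAt (Cn n) x x) := by
  have hs := h.smooth (trivializationAt (Cn r) E x) (stdVec i) (stdVec k)
  have hx := hs.contMDiffAt ((trivializationAt (Cn r) E x).open_baseSet.mem_nhds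
    (FiberBundle.mem_baseSet_trivializationAt (Cn r) E x))
  have h2 := (contMDiffAt_iff.mp hx).2
  simp only [mfld_simps] at h2
  exact (contDiffWithinAt_univ.mp h2).of_le (WithTop.coe_le_coe.mpr le_top)

theorem metricMatrix_conj (h : HermitianMetric n r E) (x : X) (z : Cn n) (i k : Fin r) :
    conj (metricMatrix h x z i k) = metricMatrix h x z k i :=
  h.conj_symm _ _ _

theorem det_metricMatrix_ne_zero (h : HermitianMetric n r E) (x : X) :
    (metricMatrix h x (chartAt (Cn n) x x)).det ≠ 0 := by
  rw [← isUnit_iff_ne_zero, ← Matrix.isUnit_iff_isUnit_det, ← Matrix.vecMul_injective_iff_isUnit]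
  rw [← Matrix.coe_vecMulLinear, ← LinearMap.ker_eq_bot, LinearMap.ker_eq_bot']
  intro c hc
  -- A vector `c` in the left kernel makes Σ c_i e_i orthogonal to the whole frame, hence to itself.
  have h1 : ∀ k, h.form x (∑ i, c i • frameBasis (r := r) E x i) (frameBasis (r := r) E x k) = 0 := by
    intro k
    have := congrFun hc k
    simpa [Matrix.vecMul, dotProduct, metricMatrix_chartAt] using this
  have h2 : ∑ i, c i • frameBasis (r := r) E x i = 0 := by
    by_contra hne
    have h3 := h.pos x _ hne
    conv at h3 => rhs; rw [map_sum]
    simp only [LinearMap.map_smulₛₗ, h1, smul_zero, Finset.sum_const_zero, lt_self_iff_false] at h3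
  have := (frameBasis (r := r) E x).repr_sum_self c
  rw [h2] at this
  rw [← this]
  simp

theorem curvatureCoeff_eq (h : HermitianMetric n r E) (x : X) (i j : Fin r) (α β : Fin n) :
    curvatureCoeff h x i j α β =
      ∑ k, curvatureMatrix (metricMatrix h x) α β (chartAt (Cn n) x x) k i *
        metricMatrix h x (chartAt (Cn n) x x) k j := by
  rw [curvatureCoeff, curvatureEnd, Matrix.toLin_self]
  simp [metricMatrix_chartAt]

/-- The Hermitian symmetry `conj R_{i j̄ α β̄} = R_{j ī β ᾱ}` of the Chern curvature. -/
theorem conj_curvatureCoeff (h : HermitianMetric n r E) (x : X) (i j : Fin r) (α β : Fin n) :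
    conj (curvatureCoeff h x i j α β) = curvatureCoeff h x j i β α := by
  rw [curvatureCoeff_eq, curvatureCoeff_eq]
  exact conj_sum_curvatureMatrix_mul (contDiffAt_metricMatrix h x) (metricMatrix_conj h x)
    (det_metricMatrix_ne_zero h x) i j α β

/-- Extends the symmetry from the holomorphic frame, where it is computed, to arbitrary vectors and
hence to unitary frames. -/
theorem conj_form_curvatureEnd (h : HermitianMetric n r E) (x : X) (α β : Fin n) (s t : E x) :
    conj (h.form x (curvatureEnd h x α β s) t) = h.form x (curvatureEnd h x β α t) s := by
  have hc := conj_curvatureCoeff h x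
  simp only [curvatureCoeff] at hc
  rw [← (frameBasis (r := r) E x).sum_repr s, ← (frameBasis (r := r) E x).sum_repr t]
  simp only [map_sum, map_smul, LinearMap.sum_apply, LinearMap.smul_apply,
    LinearMap.map_smulₛₗ, smul_eq_mul, map_mul, Complex.conj_conj, hc, Finset.mul_sum]
  rw [Finset.sum_comm]
  refine Finset.sum_congr rfl fun i _ => Finset.sum_congr rfl fun j _ => ?_
  ring

/-- The form `(v, w) ↦ h(R(v, w̄) s, t)` for `R(v, w̄) = R_{α β̄} v^α conj(w^β)`. -/
def curvatureForm (h : HermitianMetric n r E) (x : X) (s t : E x) :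
    HolTangent n x →ₗ[ℂ] HolTangent n x →ₗ⋆[ℂ] ℂ :=
  LinearMap.mk₂'ₛₗ (RingHom.id ℂ) (starRingEnd ℂ)
    (fun v w => ∑ α, ∑ β, dz x α v * conj (dz x β w) * h.form x (curvatureEnd h x α β s) t)
    (fun v v' w => by simp [add_mul, Finset.sum_add_distrib])
    (fun c v w => by simp [Finset.mul_sum, mul_assoc])
    (fun v w w' => by simp [mul_add, add_mul, Finset.sum_add_distrib])
    (fun c v w => by
      simp only [map_smul, smul_eq_mul, map_mul, Finset.mul_sum]
      exact Finset.sum_congr rfl fun _ _ => Finset.sum_congr rfl fun _ _ => by ring)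

theorem curvatureForm_apply (h : HermitianMetric n r E) (x : X) (s t : E x)
    (v w : HolTangent n x) :
    curvatureForm h x s t v w =
      ∑ α, ∑ β, dz x α v * conj (dz x β w) * h.form x (curvatureEnd h x α β s) t := rfl

theorem conj_curvatureForm (h : HermitianMetric n r E) (x : X) (s t : E x)
    (v w : HolTangent n x) :
    conj (curvatureForm h x s t v w) = curvatureForm h x t s w v := by
  simp only [curvatureForm_apply, map_sum, map_mul, Complex.conj_conj, conj_form_curvatureEnd]
  rw [Finset.sum_comm]
  exact Finset.sum_congr rfl fun _ _ => Finset.sum_congr rfl fun _ _ => by ring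

theorem curvatureForm_sum_left (h : HermitianMetric n r E) (x : X) {κ : Type*} [Fintype κ]
    (c : κ → ℂ) (s : κ → E x) (t : E x) (v w : HolTangent n x) :
    curvatureForm h x (∑ a, c a • s a) t v w = ∑ a, c a * curvatureForm h x (s a) t v w := by
  simp only [curvatureForm_apply, map_sum, map_smul, LinearMap.sum_apply, LinearMap.smul_apply,
    smul_eq_mul, Finset.mul_sum]
  rw [Finset.sum_congr rfl fun i _ => Finset.sum_comm, Finset.sum_comm]
  exact Finset.sum_congr rfl fun _ _ => Finset.sum_congr rfl fun _ _ =>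
    Finset.sum_congr rfl fun _ _ => by ring

theorem curvatureForm_sum_right (h : HermitianMetric n r E) (x : X) {κ : Type*} [Fintype κ]
    (c : κ → ℂ) (s : E x) (t : κ → E x) (v w : HolTangent n x) :
    curvatureForm h x s (∑ a, c a • t a) v w =
      ∑ a, conj (c a) * curvatureForm h x s (t a) v w := by
  rw [← conj_curvatureForm, curvatureForm_sum_left, map_sum]
  simp only [map_mul, conj_curvatureForm]

/-- The array of curvature forms with respect to a frame. -/
def frameCurvature (h : HermitianMetric n r E) {x : X} (e : Module.Basis (Fin r) ℂ (E x))
    (i j : Fin r) : HolTangent n x →ₗ[ℂ] HolTangent n x →ₗ⋆[ℂ] ℂ :=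
  curvatureForm h x (e i) (e j)

theorem isFrameChange_frameCurvature (h : HermitianMetric n r E) {x : X}
    (e e' : Module.Basis (Fin r) ℂ (E x)) :
    IsFrameChange (frameCurvature h e) (frameCurvature h e') (e'.toMatrix e) := by
  intro i j v w
  have hi : e i = ∑ a, e'.toMatrix e a i • e' a := (e'.sum_toMatrix_smul_self e i).symm
  have hj : e j = ∑ a, e'.toMatrix e a j • e' a := (e'.sum_toMatrix_smul_self e j).symm
  simp only [frameCurvature]
  rw [hi, curvatureForm_sum_left]
  refine Finset.sum_congr rfl fun a _ => ?_
  rw [hj, curvatureForm_sum_right, Finset.mul_sum]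
  exact Finset.sum_congr rfl fun b _ => by ring

/-- Connects the holomorphic frame of the definition with the unitary frames of the criterion. -/
theorem isNonnegDecomposition_frame (h : HermitianMetric n r E) {x : X}
    (e e' : Module.Basis (Fin r) ℂ (E x)) {U V : Submodule ℂ (HolTangent n x)} :
    IsNonnegDecomposition (frameCurvature h e) U V ↔
      IsNonnegDecomposition (frameCurvature h e') U V :=
  ⟨(isFrameChange_frameCurvature h e' e).isNonnegDecomposition (e'.toMatrix_mul_toMatrix_flip e),
    (isFrameChange_frameCurvature h e e').isNonnegDecomposition (e.toMatrix_mul_toMatrix_flip e')⟩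

theorem isPosDecomposition_frame (h : HermitianMetric n r E) {x : X}
    (e e' : Module.Basis (Fin r) ℂ (E x)) {U V : Submodule ℂ (HolTangent n x)} :
    IsPosDecomposition (frameCurvature h e) U V ↔
      IsPosDecomposition (frameCurvature h e') U V :=
  ⟨(isFrameChange_frameCurvature h e' e).isPosDecomposition (e'.toMatrix_mul_toMatrix_flip e),
    (isFrameChange_frameCurvature h e e').isPosDecomposition (e.toMatrix_mul_toMatrix_flip e')⟩

/-- The array of vectors `u_i = u^{i α} ∂_α`. -/
def tensorVec (x : X) (u : Fin r → Fin n → ℂ) (i : Fin r) : HolTangent n x :=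
  ∑ α, u i α • tangentVec x α

theorem tensorVec_surjective (x : X) (v : Fin r → HolTangent n x) : ∃ u, tensorVec x u = v :=
  ⟨fun i α => dz x α (v i), funext fun i => sum_dz_tangentVec x (v i)⟩

theorem tensorVec_eq_zero_iff (x : X) (u : Fin r → Fin n → ℂ) : tensorVec x u = 0 ↔ u = 0 := by
  constructor
  · intro h
    ext i α
    have := dz_sum_tangentVec x (u i) α
    rw [← this]
    change dz x α (tensorVec x u i) = 0
    simp [h]
  · rintro rfl
    ext i
    simp [tensorVec]

theorem nakanoForm_eq (h : HermitianMetric n r E) (x : X) (u v : Fin r → Fin n → ℂ) :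
    nakanoForm h x u v =
      arrayForm (frameCurvature h (frameBasis E x)) (tensorVec x u) (tensorVec x v) := by
  simp only [nakanoForm, arrayForm_apply, frameCurvature, curvatureForm_apply, tensorVec,
    dz_sum_tangentVec, curvatureCoeff]
  exact Finset.sum_congr rfl fun _ _ => Finset.sum_congr rfl fun _ _ =>
    Finset.sum_congr rfl fun _ _ => Finset.sum_congr rfl fun _ _ => by ring

theorem dualNakanoForm_eq (h : HermitianMetric n r E) (x : X) (v : Fin r → Fin n → ℂ) :
    dualNakanoForm h x v =
      arrayForm (fun i j => frameCurvature h (frameBasis E x) j i) (tensorVec x v)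
        (tensorVec x v) := by
  simp only [dualNakanoForm, arrayForm_apply, frameCurvature, curvatureForm_apply, tensorVec,
    dz_sum_tangentVec, curvatureCoeff]
  rw [Finset.sum_comm]
  exact Finset.sum_congr rfl fun _ _ => Finset.sum_congr rfl fun _ _ =>
    Finset.sum_congr rfl fun _ _ => Finset.sum_congr rfl fun _ _ => by ring

theorem isStronglyDecomposablyNonnegI_iff (h : HermitianMetric n r E) :
    IsStronglyDecomposablyNonnegI h ↔ ∀ x, ∃ U V : Submodule ℂ (HolTangent n x), IsCompl U V ∧
      IsNonnegDecomposition (frameCurvature h (frameBasis E x)) U V := by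
  refine forall_congr' fun x => exists_congr fun U => exists_congr fun V =>
    and_congr_right fun _ => ?_
  simp only [IsNonnegDecomposition, nakanoForm_eq, dualNakanoForm_eq,
    (Function.Surjective.forall (tensorVec_surjective (r := r) x)), Ne, tensorVec_eq_zero_iff]
  rfl

theorem isStronglyDecomposablyPosI_iff (h : HermitianMetric n r E) :
    IsStronglyDecomposablyPosI h ↔ ∀ x, ∃ U V : Submodule ℂ (HolTangent n x), IsCompl U V ∧
      IsPosDecomposition (frameCurvature h (frameBasis E x)) U V := by
  refine forall_congr' fun x => exists_congr fun U => exists_congr fun V =>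
    and_congr_right fun _ => ?_
  simp only [IsPosDecomposition, nakanoForm_eq, dualNakanoForm_eq,
    (Function.Surjective.forall (tensorVec_surjective (r := r) x)), Ne, tensorVec_eq_zero_iff]
  rfl

theorem repr_eq_form {h : HermitianMetric n r E} {x : X} {e : Module.Basis (Fin r) ℂ (E x)}
    (he : IsUnitaryFrame h e) (s : E x) (j : Fin r) : e.repr s j = h.form x s (e j) := by
  conv_rhs => rw [← e.sum_repr s]
  simp only [map_sum, map_smul, LinearMap.sum_apply, LinearMap.smul_apply, smul_eq_mul, he _ _,
    mul_ite, mul_one, mul_zero, Finset.sum_ite_eq', Finset.mem_univ, if_true]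

/-- Unitarity enters here: the coordinate along e_j is the pairing with e_j. -/
theorem toMatrix_chernCurvature {h : HermitianMetric n r E} {x : X}
    {e : Module.Basis (Fin r) ℂ (E x)} (he : IsUnitaryFrame h e) (v w : HolTangent n x)
    (j i : Fin r) :
    LinearMap.toMatrix e e (chernCurvature h x v w) j i =
      frameCurvature h e i j v w - frameCurvature h e i j w v := by
  rw [LinearMap.toMatrix_apply, repr_eq_form he, chernCurvature]
  simp only [frameCurvature, curvatureForm_apply, LinearMap.sum_apply, LinearMap.smul_apply,
    map_sum, map_smul, smul_eq_mul, ← Finset.sum_sub_distrib, ← sub_mul]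
  rfl

/-- Both sides of (1) are antisymmetrizations of sesquilinear forms. The difference of these forms
is symmetric over the exchange of v and w, so `sesquilinear_eq_zero_of_swap` kills it. -/
theorem curvatureFactors_iff {h : HermitianMetric n r E} {x : X}
    {e : Module.Basis (Fin r) ℂ (E x)} (he : IsUnitaryFrame h e) {N₁ N₂ : ℕ}
    (B : Matrix (Fin r) (Fin N₂) (HolTangent n x →ₗ⋆[ℂ] ℂ))
    (A : Matrix (Fin r) (Fin N₁) (HolTangent n x →ₗ[ℂ] ℂ)) :
    CurvatureFactors h e B A ↔
      IsSumOfSquares (frameCurvature h e) (fun i p => conj01 (B i p)) A := by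
  have hw : ∀ (v w : HolTangent n x) (j i : Fin r),
      -(∑ p, wedge (B j p) (conj01 (B i p)) v w) + ∑ p, wedge (A j p) (conj10 (A i p)) v w =
      (∑ p, conj01 (B i p) v * conj (conj01 (B j p) w) + ∑ p, A j p v * conj (A i p w)) -
      (∑ p, conj01 (B i p) w * conj (conj01 (B j p) v) + ∑ p, A j p w * conj (A i p v)) := by
    intro v w j i
    -- The minus sign in (1) reorders the factors: -B_j ∧ B̄_i = B̄_i ∧ B_j, whose (1,0) factor
    -- comes first.
    have h1 : ∀ p, wedge (B j p) (conj01 (B i p)) v w =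
        conj01 (B i p) w * conj (conj01 (B j p) v) -
        conj01 (B i p) v * conj (conj01 (B j p) w) := by
      intro p
      simp only [wedge, conj01, LinearMap.coe_mk, AddHom.coe_mk, Complex.conj_conj]
      ring
    simp only [h1, Finset.sum_sub_distrib]
    simp only [wedge, conj10, LinearMap.coe_mk, AddHom.coe_mk, Finset.sum_sub_distrib]
    ring
  constructor
  · intro hf i j v w
    let S : HolTangent n x →ₗ[ℂ] HolTangent n x →ₗ⋆[ℂ] ℂ :=
      LinearMap.mk₂'ₛₗ (RingHom.id ℂ) (starRingEnd ℂ)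
        (fun v w => ∑ p, conj01 (B i p) v * conj (conj01 (B j p) w) +
          ∑ p, A j p v * conj (A i p w))
        (fun v v' w => by simp only [map_add, add_mul, Finset.sum_add_distrib]; ring)
        (fun c v w => by simp [Finset.mul_sum, mul_add, mul_assoc])
        (fun v w w' => by simp only [map_add, mul_add, Finset.sum_add_distrib]; ring)
        (fun c v w => by
          simp only [map_smul, smul_eq_mul, map_mul, mul_add, Finset.mul_sum, mul_left_comm])
    have h0 := sesquilinear_eq_zero_of_swap (frameCurvature h e i j - S) (fun v w => by
      have := hf v w j i
      rw [toMatrix_chernCurvature he, hw] at this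
      change frameCurvature h e i j v w - S v w = frameCurvature h e i j w v - S w v
      change _ = S v w - S w v at this
      linear_combination this) v w
    exact sub_eq_zero.mp h0
  · intro hs v w j i
    rw [toMatrix_chernCurvature he, hw, hs, hs]

theorem rank_boldA {x : X} {N : ℕ} (A : Matrix (Fin r) (Fin N) (HolTangent n x →ₗ[ℂ] ℂ)) :
    (boldA A).rank = Module.finrank ℂ (LinearMap.range (arrayMap (ι := Fin r) A)) := by
  have h := rank_eq_finrank_range_arrayMap (ι := Fin r) (tangentBasis x) A
  simp only [tangentBasis_apply] at h
  exact h

theorem rank_boldB {x : X} {N : ℕ} (B : Matrix (Fin r) (Fin N) (HolTangent n x →ₗ⋆[ℂ] ℂ)) :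
    (boldB B).rank =
      Module.finrank ℂ (LinearMap.range (arrayMap fun i p => conj01 (B i p))) := by
  -- Transposing and then conjugate-transposing conjugates the entries of 𝐁, which leaves the rank
  -- unchanged.
  rw [← rank_eq_finrank_range_arrayMap (tangentBasis x), ← Matrix.rank_transpose,
    ← Matrix.rank_conjTranspose]
  congr 1
  ext p q
  simp [boldB, tangentBasis_apply, conj01]

theorem conj01_conj10 {x : X} (η : HolTangent n x →ₗ[ℂ] ℂ) : conj01 (conj10 η) = η := by
  ext v
  simp [conj01, conj10]

theorem conj01_apply_eq_zero_iff {x : X} (η : HolTangent n x →ₗ⋆[ℂ] ℂ) (v : HolTangent n x) :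
    conj01 η v = 0 ↔ η v = 0 := by
  simp [conj01]

theorem exists_isUnitaryFrame (h : HermitianMetric n r E) (x : X) :
    ∃ e : Module.Basis (Fin r) ℂ (E x), IsUnitaryFrame h e := by
  have : FiniteDimensional ℂ (E x) := (frameBasis (r := r) E x).finiteDimensional_of_finite
  exact exists_unitary_basis
    (by rw [Module.finrank_eq_card_basis (frameBasis (r := r) E x), Fintype.card_fin]) (h.form x)
    (h.conj_symm x) (h.pos x)

/-- Takes B = φ̄ and A = ψ from the square roots. The vanishing on `V` and `U` is kept because it
gives the rank criterion for the same decomposition. -/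
theorem exists_curvatureFactors_of_isNonnegDecomposition {h : HermitianMetric n r E} {x : X}
    {e : Module.Basis (Fin r) ℂ (E x)} (he : IsUnitaryFrame h e)
    {U V : Submodule ℂ (HolTangent n x)} (hUV : IsCompl U V)
    (hd : IsNonnegDecomposition (frameCurvature h e) U V) :
    ∃ (N₁ N₂ : ℕ) (B : Matrix (Fin r) (Fin N₂) (HolTangent n x →ₗ⋆[ℂ] ℂ))
      (A : Matrix (Fin r) (Fin N₁) (HolTangent n x →ₗ[ℂ] ℂ)),
      CurvatureFactors h e B A ∧ spanBBar B ⊓ spanA A = ⊥ ∧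
        (∀ i p, ∀ v ∈ V, B i p v = 0) ∧ (∀ i p, ∀ u ∈ U, A i p u = 0) := by
  obtain ⟨N₁, N₂, φ, ψ, hs, hφ, hψ⟩ := hd.exists_isSumOfSquares hUV
    fun i j v w => conj_curvatureForm h x (e i) (e j) v w
  have hB : (fun i p => conj01 (conj10 (φ i p))) = φ := by
    simp only [conj01_conj10]
  refine ⟨N₁, N₂, Matrix.of fun i p => conj10 (φ i p), Matrix.of ψ,
    (curvatureFactors_iff he _ _).mpr ?_, ?_, fun i p v hv => ?_, hψ⟩
  · simp only [Matrix.of_apply, hB]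
    exact hs
  · have := arraySpan_inf_eq_bot hUV hφ hψ
    rw [← hB] at this
    exact this
  · rw [← conj01_apply_eq_zero_iff, Matrix.of_apply, conj01_conj10]
    exact hφ i p v hv

theorem isPosDecomposition_iff_rank {h : HermitianMetric n r E} {x : X}
    {e : Module.Basis (Fin r) ℂ (E x)} (he : IsUnitaryFrame h e) {N₁ N₂ : ℕ}
    {B : Matrix (Fin r) (Fin N₂) (HolTangent n x →ₗ⋆[ℂ] ℂ)}
    {A : Matrix (Fin r) (Fin N₁) (HolTangent n x →ₗ[ℂ] ℂ)} (hf : CurvatureFactors h e B A)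
    {U V : Submodule ℂ (HolTangent n x)} (hUV : IsCompl U V)
    (hB : ∀ i p, ∀ v ∈ V, B i p v = 0) (hA : ∀ i p, ∀ u ∈ U, A i p u = 0) :
    IsPosDecomposition (frameCurvature h e) U V ↔
      (boldA A).rank = r * Module.finrank ℂ V ∧ (boldB B).rank = r * Module.finrank ℂ U := by
  rw [((curvatureFactors_iff he B A).mp hf).isPosDecomposition_iff hUV
    (fun i p v hv => (conj01_apply_eq_zero_iff _ v).mpr (hB i p v hv)) hA, rank_boldA, rank_boldB,
    Fintype.card_fin]

end Curvature
end ChernCriterion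

end

/-! ### The criterion -/

theorem theorem4p1 {n r : ℕ} {X : Type*} [TopologicalSpace X] [ChartedSpace (ChernCriterion.Cn n) X]
    [IsManifold 𝓘(ℂ, ChernCriterion.Cn n) ω X]
    {E : X → Type*} [TopologicalSpace (TotalSpace (ChernCriterion.Cn r) E)]
    [∀ x, AddCommGroup (E x)] [∀ x, Module ℂ (E x)] [∀ x, TopologicalSpace (E x)]
    [FiberBundle (ChernCriterion.Cn r) E] [VectorBundle ℂ (ChernCriterion.Cn r) E]
    [ContMDiffVectorBundle ω (ChernCriterion.Cn r) E 𝓘(ℂ, ChernCriterion.Cn n)]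
    (h : ChernCriterion.HermitianMetric n r E) :
    -- non-negativity: the criterion in one unitary frame, and in every unitary frame
    (ChernCriterion.IsStronglyDecomposablyNonnegI h ↔
      ∀ x : X, ∃ e : Module.Basis (Fin r) ℂ (E x), ChernCriterion.IsUnitaryFrame h e ∧
        ∃ (N₁ N₂ : ℕ)
          (B : Matrix (Fin r) (Fin N₂) (ChernCriterion.HolTangent n x →ₗ⋆[ℂ] ℂ))
          (A : Matrix (Fin r) (Fin N₁) (ChernCriterion.HolTangent n x →ₗ[ℂ] ℂ)),
          ChernCriterion.CurvatureFactors h e B A ∧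
          ChernCriterion.spanBBar B ⊓ ChernCriterion.spanA A = ⊥) ∧
    (ChernCriterion.IsStronglyDecomposablyNonnegI h ↔
      ∀ x : X, ∀ e : Module.Basis (Fin r) ℂ (E x), ChernCriterion.IsUnitaryFrame h e →
        ∃ (N₁ N₂ : ℕ)
          (B : Matrix (Fin r) (Fin N₂) (ChernCriterion.HolTangent n x →ₗ⋆[ℂ] ℂ))
          (A : Matrix (Fin r) (Fin N₁) (ChernCriterion.HolTangent n x →ₗ[ℂ] ℂ)),
          ChernCriterion.CurvatureFactors h e B A ∧
          ChernCriterion.spanBBar B ⊓ ChernCriterion.spanA A = ⊥) ∧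
    -- positivity: in one unitary frame, with only the dimensions of `U` and `V` prescribed
    (ChernCriterion.IsStronglyDecomposablyPosI h ↔
      ∀ x : X, ∃ e : Module.Basis (Fin r) ℂ (E x), ChernCriterion.IsUnitaryFrame h e ∧
        ∃ (N₁ N₂ : ℕ)
          (B : Matrix (Fin r) (Fin N₂) (ChernCriterion.HolTangent n x →ₗ⋆[ℂ] ℂ))
          (A : Matrix (Fin r) (Fin N₁) (ChernCriterion.HolTangent n x →ₗ[ℂ] ℂ)),
          ChernCriterion.CurvatureFactors h e B A ∧
          ChernCriterion.spanBBar B ⊓ ChernCriterion.spanA A = ⊥ ∧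
          ∃ U V : Submodule ℂ (ChernCriterion.HolTangent n x), IsCompl U V ∧
            (ChernCriterion.boldA A).rank = r * Module.finrank ℂ V ∧
            (ChernCriterion.boldB B).rank = r * Module.finrank ℂ U) ∧
    -- positivity: in every unitary frame, with entries of `B̄` in `U*` and entries of `A` in `V*`
    (ChernCriterion.IsStronglyDecomposablyPosI h ↔
      ∀ x : X, ∀ e : Module.Basis (Fin r) ℂ (E x), ChernCriterion.IsUnitaryFrame h e →
        ∃ (N₁ N₂ : ℕ)
          (B : Matrix (Fin r) (Fin N₂) (ChernCriterion.HolTangent n x →ₗ⋆[ℂ] ℂ))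
          (A : Matrix (Fin r) (Fin N₁) (ChernCriterion.HolTangent n x →ₗ[ℂ] ℂ)),
          ChernCriterion.CurvatureFactors h e B A ∧
          ChernCriterion.spanBBar B ⊓ ChernCriterion.spanA A = ⊥ ∧
          ∃ U V : Submodule ℂ (ChernCriterion.HolTangent n x), IsCompl U V ∧
            (∀ i p, ∀ v ∈ V, B i p v = 0) ∧ (∀ i p, ∀ u ∈ U, A i p u = 0) ∧
            (ChernCriterion.boldA A).rank = r * Module.finrank ℂ V ∧
            (ChernCriterion.boldB B).rank = r * Module.finrank ℂ U) := by
  have nonneg_of_exists : ∀ {x : X} {e : Module.Basis (Fin r) ℂ (E x)},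
      ChernCriterion.IsUnitaryFrame h e → ∀ {N₁ N₂ : ℕ}
      {B : Matrix (Fin r) (Fin N₂) (ChernCriterion.HolTangent n x →ₗ⋆[ℂ] ℂ)}
      {A : Matrix (Fin r) (Fin N₁) (ChernCriterion.HolTangent n x →ₗ[ℂ] ℂ)},
      ChernCriterion.CurvatureFactors h e B A →
      ChernCriterion.spanBBar B ⊓ ChernCriterion.spanA A = ⊥ →
      ∃ U V : Submodule ℂ (ChernCriterion.HolTangent n x), IsCompl U V ∧
        ChernCriterion.IsNonnegDecomposition
          (ChernCriterion.frameCurvature h (ChernCriterion.frameBasis E x)) U V := by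
    intro x e he N₁ N₂ B A hf hs
    obtain ⟨U, V, hUV, hd⟩ :=
      ((ChernCriterion.curvatureFactors_iff he B A).mp hf).exists_isNonnegDecomposition hs
    exact ⟨U, V, hUV, (ChernCriterion.isNonnegDecomposition_frame h _ _).mp hd⟩
  have pos_of_exists : ∀ {x : X} {e : Module.Basis (Fin r) ℂ (E x)},
      ChernCriterion.IsUnitaryFrame h e → ∀ {N₁ N₂ : ℕ}
      {B : Matrix (Fin r) (Fin N₂) (ChernCriterion.HolTangent n x →ₗ⋆[ℂ] ℂ)}
      {A : Matrix (Fin r) (Fin N₁) (ChernCriterion.HolTangent n x →ₗ[ℂ] ℂ)},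
      ChernCriterion.CurvatureFactors h e B A →
      ChernCriterion.spanBBar B ⊓ ChernCriterion.spanA A = ⊥ →
      ∀ {U V : Submodule ℂ (ChernCriterion.HolTangent n x)}, IsCompl U V →
      (ChernCriterion.boldA A).rank = r * Module.finrank ℂ V →
      (ChernCriterion.boldB B).rank = r * Module.finrank ℂ U →
      ∃ U V : Submodule ℂ (ChernCriterion.HolTangent n x), IsCompl U V ∧
        ChernCriterion.IsPosDecomposition
          (ChernCriterion.frameCurvature h (ChernCriterion.frameBasis E x)) U V := by
    intro x e he N₁ N₂ B A hf hs U V hUV hA hB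
    rw [ChernCriterion.rank_boldA] at hA
    rw [ChernCriterion.rank_boldB] at hB
    -- A new pair replaces the given one, on which the entries of A and B̄ need not vanish.
    obtain ⟨U, V, hUV, hd⟩ :=
      ((ChernCriterion.curvatureFactors_iff he B A).mp hf).exists_isPosDecomposition hs hUV
        (by rwa [Fintype.card_fin]) (by rwa [Fintype.card_fin])
    exact ⟨U, V, hUV, (ChernCriterion.isPosDecomposition_frame h _ _).mp hd⟩
  rw [ChernCriterion.isStronglyDecomposablyNonnegI_iff,
    ChernCriterion.isStronglyDecomposablyPosI_iff]
  refine ⟨⟨fun H x => ?_, fun H x => ?_⟩, ⟨fun H x e he => ?_, fun H x => ?_⟩,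
    ⟨fun H x => ?_, fun H x => ?_⟩, ⟨fun H x e he => ?_, fun H x => ?_⟩⟩
  · obtain ⟨e, he⟩ := ChernCriterion.exists_isUnitaryFrame h x
    obtain ⟨U, V, hUV, hd⟩ := H x
    obtain ⟨N₁, N₂, B, A, hf, hs, -⟩ :=
      ChernCriterion.exists_curvatureFactors_of_isNonnegDecomposition he hUV
        ((ChernCriterion.isNonnegDecomposition_frame h _ _).mp hd)
    exact ⟨e, he, N₁, N₂, B, A, hf, hs⟩
  · obtain ⟨e, he, N₁, N₂, B, A, hf, hs⟩ := H x
    exact nonneg_of_exists he hf hs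
  · obtain ⟨U, V, hUV, hd⟩ := H x
    obtain ⟨N₁, N₂, B, A, hf, hs, -⟩ :=
      ChernCriterion.exists_curvatureFactors_of_isNonnegDecomposition he hUV
        ((ChernCriterion.isNonnegDecomposition_frame h _ _).mp hd)
    exact ⟨N₁, N₂, B, A, hf, hs⟩
  -- The condition on all unitary frames has content because at least one exists.
  · obtain ⟨e, he⟩ := ChernCriterion.exists_isUnitaryFrame h x
    obtain ⟨N₁, N₂, B, A, hf, hs⟩ := H x e he
    exact nonneg_of_exists he hf hs
  · obtain ⟨e, he⟩ := ChernCriterion.exists_isUnitaryFrame h x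
    obtain ⟨U, V, hUV, hd⟩ := H x
    have hd' := (ChernCriterion.isPosDecomposition_frame h _ e).mp hd
    obtain ⟨N₁, N₂, B, A, hf, hs, hB, hA⟩ :=
      ChernCriterion.exists_curvatureFactors_of_isNonnegDecomposition he hUV
        hd'.isNonnegDecomposition
    exact ⟨e, he, N₁, N₂, B, A, hf, hs, U, V, hUV,
      (ChernCriterion.isPosDecomposition_iff_rank he hf hUV hB hA).mp hd'⟩
  · obtain ⟨e, he, N₁, N₂, B, A, hf, hs, U, V, hUV, hA, hB⟩ := H x
    exact pos_of_exists he hf hs hUV hA hB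
  · obtain ⟨U, V, hUV, hd⟩ := H x
    have hd' := (ChernCriterion.isPosDecomposition_frame h _ e).mp hd
    obtain ⟨N₁, N₂, B, A, hf, hs, hB, hA⟩ :=
      ChernCriterion.exists_curvatureFactors_of_isNonnegDecomposition he hUV
        hd'.isNonnegDecomposition
    exact ⟨N₁, N₂, B, A, hf, hs, U, V, hUV, hB, hA,
      (ChernCriterion.isPosDecomposition_iff_rank he hf hUV hB hA).mp hd'⟩
  · obtain ⟨e, he⟩ := ChernCriterion.exists_isUnitaryFrame h x
    obtain ⟨N₁, N₂, B, A, hf, hs, U, V, hUV, -, -, hA, hB⟩ := H x e he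
    exact pos_of_exists he hf hs hUV hA hB
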